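/- **Theorem 3.1.** Let $\Lambda=\{n+m\omega : n,m\in\mathbb Z\}$ with $\operatorname{Im}\omega>0$, let $\pi:\mathbb C\to\mathbb C/\Lambda$ be the natural projection, and let $A:\mathbb C/\Lambda\to\mathbb C/\Lambda$, $A(z)=az+b \pmod\Lambda$ with $a,b\in\mathbb C$, be a covering of the torus of degree at least $2$. A continuum is a compact connected set. A continuum $E\subset\mathbb C/\Lambda$ is called *simply-connected* if there is a simply-connected domain $U\subset\mathbb C/\Lambda$ such that $E\subset U$ and $U\setminus E$ is connected. A *wandering continuum* of $A$ is a continuum $E\subset\mathbb C/\Lambda$ with more than one point such that $A^n(E)\cap A^m(E)=\emptyset$ for all $n>m\ge 0$; it is *eventually simply-connected* if there is an $N\ge 0$ such that $A^n(E)$ is simply-connected for every $n\ge N$. Then $A$ admits an eventually simply-connected wandering continuum if and only if $a$ is an integer. Moreover, every eventually simply-connected wandering continuum $E$ of $A$ is a line segment in an infinite geodesic under the flat metric. That is, $E=\pi([z,w])$ for some distinct $z,w\in\mathbb C$, and $E=\gamma([s,t])$ for some $s<t$ and some injective map $\gamma:\mathbb R\to\mathbb C/\Lambda$ that is locally distance-preserving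 for the flat distance $d(\pi(u),\pi(v))=\inf_{\lambda\in\Lambda}|u-v+\lambda|$. -/

import Mathlib

open Set

namespace FlatTorus

/-- The lattice `Λ = {n + m ω : n, m ∈ ℤ}` in the complex plane. -/
def lattice (ω : ℂ) : AddSubgroup ℂ where
  carrier := {z | ∃ n m : ℤ, z = n + m * ω}
  zero_mem' := ⟨0, 0, by simp⟩
  add_mem' := by
    rintro _ _ ⟨n, m, rfl⟩ ⟨n', m', rfl⟩
    exact ⟨n + n', m + m', by push_cast; ring⟩
  neg_mem' := by
    rintro _ ⟨n, m, rfl⟩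
    exact ⟨-n, -m, by push_cast; ring⟩

/-- The torus `ℂ / Λ`. It carries the quotient topology and Mathlib's quotient distance
`dist (π z) (π w) = inf {|z - w + l| : l ∈ Λ}`, which is the distance of the flat metric. -/
abbrev Torus (ω : ℂ) : Type := ℂ ⧸ lattice ω

/-- The natural projection `π : ℂ → ℂ / Λ`. -/
def proj (ω : ℂ) (z : ℂ) : Torus ω := QuotientAddGroup.mk z

/-- `A` is the map `z ↦ a z + b (mod Λ)` of the torus `ℂ / Λ` to itself. -/
def IsAffine (ω a b : ℂ) (A : Torus ω → Torus ω) : Prop :=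
  ∀ z : ℂ, A (proj ω z) = proj ω (a * z + b)

/-- `A` is a covering map of finite degree `d`, that is, all its fibres have exactly `d` points
(for `d ≥ 1`). -/
def IsCoveringOfDegree {X Y : Type*} [TopologicalSpace X] [TopologicalSpace Y]
    (A : X → Y) (d : ℕ) : Prop :=
  IsCoveringMap A ∧ ∀ y : Y, (A ⁻¹' {y}).Finite ∧ (A ⁻¹' {y}).ncard = d

/-- A wandering continuum of `A`: a compact connected set with more than one point whose iterated
images are pairwise disjoint. -/
def IsWanderingContinuum {X : Type*} [TopologicalSpace X] (A : X → X) (E : Set X) : Prop :=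
  IsCompact E ∧ IsConnected E ∧ E.Nontrivial ∧
    ∀ m n : ℕ, m < n → Disjoint (A^[m] '' E) (A^[n] '' E)

/-- The set `E` (a continuum) is simply-connected: it lies in a simply-connected domain `U`
such that `U \ E` is connected. -/
def IsSimplyConnectedContinuum {X : Type*} [TopologicalSpace X] (E : Set X) : Prop :=
  IsCompact E ∧ IsConnected E ∧
    ∃ U : Set X, IsOpen U ∧ IsSimplyConnected U ∧ E ⊆ U ∧ IsConnected (U \ E)

/-- An eventually simply-connected wandering continuum: a wandering continuum `E` such that
the images `A^n(E)` are simply-connected for all sufficiently large `n`. -/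
def IsEventuallySCWanderingContinuum {X : Type*} [TopologicalSpace X]
    (A : X → X) (E : Set X) : Prop :=
  IsWanderingContinuum A E ∧ ∃ N : ℕ, ∀ n : ℕ, N ≤ n → IsSimplyConnectedContinuum (A^[n] '' E)

/-- A (complete, unit speed) geodesic of a metric: a locally distance-preserving map
defined on the whole real line. -/
def IsGeodesic {X : Type*} [PseudoMetricSpace X] (γ : ℝ → X) : Prop :=
  ∀ t : ℝ, ∃ ε > 0, ∀ s ∈ Metric.ball t ε, ∀ s' ∈ Metric.ball t ε,
    dist (γ s) (γ s') = dist s s'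

/-- An infinite geodesic: a geodesic that does not close up or cross itself. -/
def IsInfiniteGeodesic {X : Type*} [PseudoMetricSpace X] (γ : ℝ → X) : Prop :=
  IsGeodesic γ ∧ Function.Injective γ

/-- `E` is a line segment of the torus: the projection of a non-degenerate segment of `ℂ`. -/
def IsLineSegment (ω : ℂ) (E : Set (Torus ω)) : Prop :=
  ∃ z w : ℂ, z ≠ w ∧ E = proj ω '' segment ℝ z w

/-- `E` is a line segment in an infinite geodesic under the flat metric: it is a line segment,
and it is a compact arc of an infinite geodesic. -/
def IsLineSegmentInInfiniteGeodesic (ω : ℂ) (E : Set (Torus ω)) : Prop :=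
  IsLineSegment ω E ∧
    ∃ γ : ℝ → Torus ω, IsInfiniteGeodesic γ ∧ ∃ s t : ℝ, s < t ∧ E = γ '' Icc s t

end FlatTorus

/-! A covering of degree at least two has `‖a‖ > 1`, and `a` maps the lattice into itself. Let `E`
be an eventually simply-connected wandering continuum. Some image of `E` lies in a simply-connected
domain, so `E` lifts to a planar continuum `K`. For large `n` the projection is injective on the
lifted `n`-th image. Hence `K - K` contains no point `l / a ^ n` with `l ≠ 0` in the lattice and `n`
large. These points are dense in the plane, so `K - K` has empty interior.

The planar fact `interior_sub_nonempty` says that this forces `K` onto a line, so `K` is a segment.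
Its proof compares `K` with its closed convex hull `C`. If `K` contains the frontier of `C`, a
translate of `K` disjoint from `K` that meets the interior of `C` is trapped in `C`, which the
extreme point in the direction of translation forbids. Otherwise `K` misses a frontier point of `C`.
It then touches a supporting line on both sides of that point, and a winding number argument shows
that `K` meets its translates by an open set of vectors.

If `a` is not real, consecutive images of a segment are not parallel and become long compared with a
fundamental domain, so they cross on the torus and the segment does not wander. Hence `a` is real,
and `a = a * 1` lies in the lattice, so `a` is an integer. A lattice vector along the segment,
divided by a high power of `a`, would fall into `K - K`. So the line through `K` projects
injectively, which is the infinite geodesic. Conversely, for an integer multiplier, a segment in an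
irrational direction on a generic parallel line wanders. -/

namespace FlatTorus

open Topology Metric

/-! ### The lattice and the projection -/

section Lattice

variable {ω : ℂ}

theorem mem_lattice {z : ℂ} : z ∈ lattice ω ↔ ∃ n m : ℤ, z = n + m * ω := Iff.rfl

theorem one_mem_lattice : (1 : ℂ) ∈ lattice ω := ⟨1, 0, by simp⟩

theorem proj_eq_proj_iff {z w : ℂ} : proj ω z = proj ω w ↔ w - z ∈ lattice ω := by
  unfold proj
  rw [QuotientAddGroup.eq, sub_eq_neg_add]

theorem proj_add_mem {z l : ℂ} (hl : l ∈ lattice ω) : proj ω (z + l) = proj ω z := by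
  rw [eq_comm, proj_eq_proj_iff]
  simpa using hl

theorem proj_surjective : Function.Surjective (proj ω) := QuotientAddGroup.mk_surjective

theorem continuous_proj : Continuous (proj ω) := QuotientAddGroup.continuous_mk

theorem exists_le_norm_of_mem_lattice (hω : 0 < ω.im) :
    ∃ δ > 0, ∀ l ∈ lattice ω, l ≠ 0 → δ ≤ ‖l‖ := by
  refine ⟨min 1 ω.im, lt_min one_pos hω, ?_⟩
  rintro _ ⟨n, m, rfl⟩ h0
  by_cases hm : m = 0
  · subst hm
    have hn : n ≠ 0 := by rintro rfl; simp at h0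
    refine (min_le_left _ _).trans ?_
    simp only [Int.cast_zero, zero_mul, add_zero, Complex.norm_intCast]
    exact_mod_cast Int.one_le_abs hn
  · refine (min_le_right _ _).trans (le_trans ?_ (Complex.abs_im_le_norm _))
    have h1 : (1 : ℝ) ≤ |(m : ℝ)| := by exact_mod_cast Int.one_le_abs hm
    simp only [Complex.add_im, Complex.intCast_im, Complex.mul_im, Complex.intCast_re, zero_mul,
      add_zero, zero_add, abs_mul, abs_of_pos hω]
    nlinarith

theorem exists_mem_lattice_norm_sub_le (hω : 0 < ω.im) :
    ∃ R : ℝ, ∀ z : ℂ, ∃ l ∈ lattice ω, ‖z - l‖ ≤ R := by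
  refine ⟨1 + ‖ω‖, fun z ↦ ?_⟩
  set y : ℝ := z.im / ω.im with hy
  set x : ℝ := z.re - y * ω.re with hx
  refine ⟨(⌊x⌋ : ℤ) + (⌊y⌋ : ℤ) * ω, ⟨_, _, rfl⟩, ?_⟩
  have hz : z = x + y * ω := by
    apply Complex.ext
    · simp [hx]
    · simp [hy, hω.ne']
  have : z - ((⌊x⌋ : ℤ) + (⌊y⌋ : ℤ) * ω) = (Int.fract x : ℝ) + (Int.fract y : ℝ) * ω := by
    rw [Int.fract, Int.fract]
    push_cast
    conv_lhs => rw [hz]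
    ring
  rw [this]
  refine (norm_add_le _ _).trans ?_
  rw [norm_mul, Complex.norm_real, Complex.norm_real, Real.norm_of_nonneg (Int.fract_nonneg _),
    Real.norm_of_nonneg (Int.fract_nonneg _)]
  have h1 := (Int.fract_lt_one x).le
  have h2 := (Int.fract_lt_one y).le
  have := norm_nonneg ω
  nlinarith

theorem isDiscrete_lattice (hω : 0 < ω.im) : IsDiscrete (lattice ω : Set ℂ) := by
  obtain ⟨δ, hδ, h⟩ := exists_le_norm_of_mem_lattice hω
  rw [isDiscrete_iff_forall_mem_exists_isOpen]
  intro x hx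
  refine ⟨ball x δ, isOpen_ball, ?_⟩
  ext y
  simp only [mem_inter_iff, mem_ball, SetLike.mem_coe, mem_singleton_iff]
  constructor
  · rintro ⟨h1, h2⟩
    by_contra hne
    have := h (y - x) (sub_mem h2 hx) (sub_ne_zero.2 hne)
    rw [dist_eq_norm] at h1
    linarith
  · rintro rfl
    exact ⟨by simpa using hδ, hx⟩

theorem isClosed_lattice (hω : 0 < ω.im) : IsClosed (lattice ω : Set ℂ) := by
  have : DiscreteTopology (lattice ω) :=
    SetLike.isDiscrete_iff_discreteTopology.1 (isDiscrete_lattice hω)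
  exact AddSubgroup.isClosed_of_discrete

theorem t2Space_torus (hω : 0 < ω.im) : T2Space (Torus ω) := by
  have := isClosed_lattice hω
  infer_instance

theorem locallyPathConnectedSpace_torus : LocallyPathConnectedSpace (Torus ω) :=
  QuotientAddGroup.isOpenQuotientMap_mk.isQuotientMap.locallyPathConnectedSpace

theorem isCoveringMap_proj (hω : 0 < ω.im) : IsCoveringMap (proj ω) :=
  ((lattice ω).isAddQuotientCoveringMap_of_comm (isDiscrete_lattice hω)).isCoveringMap

theorem isOpenMap_proj : IsOpenMap (proj ω) := QuotientAddGroup.isOpenMap_coe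

/-- Any other representative of the difference is off by a nonzero lattice vector, so its norm is at
least `δ - δ / 2`. This makes straight lines local isometries into the torus. -/
theorem dist_proj_eq {δ : ℝ} (h : ∀ l ∈ lattice ω, l ≠ 0 → δ ≤ ‖l‖) {z w : ℂ}
    (hzw : ‖z - w‖ ≤ δ / 2) : dist (proj ω z) (proj ω w) = ‖z - w‖ := by
  rw [dist_eq_norm]
  change ‖((z - w : ℂ) : ℂ ⧸ lattice ω)‖ = _
  apply le_antisymm
  · exact QuotientAddGroup.norm_mk_le_norm
  · rw [QuotientAddGroup.le_norm_iff]
    intro m hm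
    have hl : z - w - m ∈ lattice ω := proj_eq_proj_iff.1 hm
    by_cases h0 : z - w - m = 0
    · rw [sub_eq_zero.1 h0]
    · have h1 := h _ hl h0
      have h2 := norm_sub_le (z - w) m
      linarith

end Lattice

end FlatTorus

namespace PlanarContinuum

/-! ### Chords of planar continua -/

open Topology Metric

open scoped Pointwise

/-- Serves to trap a continuous argument between consecutive zeros of the sine. -/
theorem mapsTo_Ioo_of_ne {X : Type*} [TopologicalSpace X] {S : Set X} (hS : IsPreconnected S)
    {g : X → ℝ} (hg : ContinuousOn g S) {a b : ℝ} (ha : ∀ x ∈ S, g x ≠ a) (hb : ∀ x ∈ S, g x ≠ b)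
    {x₀ : X} (hx₀ : x₀ ∈ S) (h₀ : g x₀ ∈ Ioo a b) : MapsTo g S (Ioo a b) := by
  have hI : (g '' S).OrdConnected := (hS.image g hg).ordConnected
  intro x hx
  constructor
  · by_contra! hlt
    obtain ⟨y, hy, hya⟩ := hI.out (mem_image_of_mem g hx) (mem_image_of_mem g hx₀) ⟨hlt, h₀.1.le⟩
    exact ha y hy hya
  · by_contra! hlt
    obtain ⟨y, hy, hya⟩ := hI.out (mem_image_of_mem g hx₀) (mem_image_of_mem g hx) ⟨h₀.2.le, hlt⟩
    exact hb y hy hya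

/-- A nowhere vanishing map of the square cannot have winding number `1` along its boundary: here
it is in the upper half plane on three sides, and it turns through the lower half plane on the
fourth. -/
theorem exists_eq_zero_of_boundary {F : ℝ × ℝ → ℂ} (hF : Continuous F)
    (h0 : ∀ t ∈ Icc (0 : ℝ) 1, 0 < (F (0, t)).im) (h1 : ∀ t ∈ Icc (0 : ℝ) 1, 0 < (F (1, t)).im)
    (htop : ∀ s ∈ Icc (0 : ℝ) 1, 0 < (F (s, 1)).im)
    (hbot : ∀ s ∈ Icc (0 : ℝ) 1, ¬ ((F (s, 0)).re = 0 ∧ 0 ≤ (F (s, 0)).im))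
    (hre0 : 0 < (F (0, 0)).re) (hre1 : (F (1, 0)).re < 0) : ∃ x, F x = 0 := by
  by_contra! hne
  -- The plane is simply connected, so `F` has a continuous logarithm; its imaginary part is an
  -- argument to follow along the boundary.
  obtain ⟨G, ⟨-, hG⟩, -⟩ := Complex.isCoveringMapOn_exp.existsUnique_continuousMap_lifts
    (⟨F, hF⟩ : C(ℝ × ℝ, ℂ)) (a₀ := (0, 0)) (e₀ := Complex.log (F (0, 0)))
    (Complex.exp_log (hne _)) (fun x ↦ hne x)
  have hexp : ∀ x, Complex.exp (G x) = F x := fun x ↦ congr_fun hG x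
  have hre : ∀ x, (F x).re = Real.exp (G x).re * Real.cos (G x).im := fun x ↦ by
    rw [← hexp, Complex.exp_re]
  have him : ∀ x, (F x).im = Real.exp (G x).re * Real.sin (G x).im := fun x ↦ by
    rw [← hexp, Complex.exp_im]
  have hgc : Continuous fun x ↦ (G x).im := Complex.continuous_im.comp G.continuous
  -- The argument at the corner `(0, 0)`, up to a multiple of `2π`.
  obtain ⟨k, hk⟩ : ∃ k : ℤ, (G (0, 0)).im - k * (2 * Real.pi) ∈ Ico (0 : ℝ) (0 + 2 * Real.pi) := by
    obtain ⟨k, hk, -⟩ := existsUnique_sub_zsmul_mem_Ico Real.two_pi_pos (G (0, 0)).im 0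
    exact ⟨k, by simpa using hk⟩
  set g : ℝ × ℝ → ℝ := fun x ↦ (G x).im - k * (2 * Real.pi) with hgdef
  have hg : Continuous g := hgc.sub continuous_const
  have hsin : ∀ x, Real.sin (g x) = Real.sin (G x).im := fun x ↦ Real.sin_sub_int_mul_two_pi _ _
  have hcos : ∀ x, Real.cos (g x) = Real.cos (G x).im := fun x ↦ Real.cos_sub_int_mul_two_pi _ _
  have hsinpos : ∀ x, 0 < (F x).im → 0 < Real.sin (g x) := fun x hx ↦ by
    rw [hsin]
    rw [him] at hx
    exact pos_of_mul_pos_right hx (Real.exp_pos _).le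
  have hpi := Real.pi_pos
  have hside : ∀ S : Set (ℝ × ℝ), IsPreconnected S → (∀ x ∈ S, 0 < (F x).im) → ∀ x₀ ∈ S,
      g x₀ ∈ Ioo 0 Real.pi → MapsTo g S (Ioo 0 Real.pi) := by
    intro S hS hpos x₀ hx₀ hx
    refine mapsTo_Ioo_of_ne hS hg.continuousOn ?_ ?_ hx₀ hx
    · intro x hx h
      have := hsinpos x (hpos x hx)
      simp [h] at this
    · intro x hx h
      have := hsinpos x (hpos x hx)
      simp [h] at this
  have hz : (0 : ℝ) ∈ Icc (0 : ℝ) 1 := by simp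
  have ho : (1 : ℝ) ∈ Icc (0 : ℝ) 1 := by simp
  have hc00 : g (0, 0) ∈ Ioo 0 Real.pi := by
    have hs := hsinpos _ (h0 0 hz)
    refine ⟨lt_of_le_of_ne hk.1 fun h ↦ ?_, ?_⟩
    · rw [← h] at hs
      simp at hs
    · by_contra! hle
      have : Real.sin (g (0, 0) - Real.pi) = -Real.sin (g (0, 0)) := Real.sin_sub_pi _
      have h2 : 0 ≤ Real.sin (g (0, 0) - Real.pi) :=
        Real.sin_nonneg_of_nonneg_of_le_pi (by linarith) (by
          have : g (0, 0) < 0 + 2 * Real.pi := hk.2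
          linarith)
      linarith
  have hI : IsPreconnected (Icc (0 : ℝ) 1) := isPreconnected_Icc
  have hc01 : g (0, 1) ∈ Ioo 0 Real.pi := by
    refine hside ((fun t ↦ ((0 : ℝ), t)) '' Icc 0 1) (hI.image _ (by fun_prop)) ?_ (0, 0)
      ⟨0, hz, rfl⟩ hc00 ⟨1, ho, rfl⟩
    rintro _ ⟨t, ht, rfl⟩
    exact h0 t ht
  have hc11 : g (1, 1) ∈ Ioo 0 Real.pi := by
    refine hside ((fun t ↦ (t, (1 : ℝ))) '' Icc 0 1) (hI.image _ (by fun_prop)) ?_ (0, 1)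
      ⟨0, hz, rfl⟩ hc01 ⟨1, ho, rfl⟩
    rintro _ ⟨t, ht, rfl⟩
    exact htop t ht
  have hc10 : g (1, 0) ∈ Ioo 0 Real.pi := by
    refine hside ((fun t ↦ ((1 : ℝ), t)) '' Icc 0 1) (hI.image _ (by fun_prop)) ?_ (1, 1)
      ⟨1, ho, rfl⟩ hc11 ⟨0, hz, rfl⟩
    rintro _ ⟨t, ht, rfl⟩
    exact h1 t ht
  have hcpos : 0 < Real.cos (g (0, 0)) := by
    rw [hcos]
    rw [hre] at hre0
    exact pos_of_mul_pos_right hre0 (Real.exp_pos _).le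
  have hcneg : Real.cos (g (1, 0)) < 0 := by
    rw [hcos]
    rw [hre] at hre1
    exact neg_of_mul_neg_right hre1 (Real.exp_pos _).le
  -- Along three sides the argument stays in `(0, π)`, so the signs of the cosine place the two
  -- bottom corners on either side of `π / 2`. On the bottom side it takes the value `π / 2`, where
  -- `F` is on the positive imaginary axis.
  have hlo : g (0, 0) ≤ Real.pi / 2 := by
    by_contra! h
    have := Real.cos_neg_of_pi_div_two_lt_of_lt h (by linarith [hc00.2])
    linarith
  have hhi : Real.pi / 2 ≤ g (1, 0) := by
    by_contra! h
    have := Real.cos_pos_of_mem_Ioo ⟨by linarith [hc10.1], h⟩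
    linarith
  obtain ⟨s, hs, hgs⟩ := intermediate_value_Icc (f := fun s ↦ g (s, 0)) zero_le_one
    (by fun_prop) ⟨hlo, hhi⟩
  refine hbot s hs ⟨?_, ?_⟩
  · rw [hre, ← hcos]
    simp [hgs]
  · rw [him, ← hsin]
    simp only [hgs, Real.sin_pi_div_two, mul_one]
    positivity

theorem isConnected_thickening {K : Set ℂ} (hK : IsConnected K) {ε : ℝ} (hε : 0 < ε) :
    IsConnected (thickening ε K) := by
  rw [← add_ball_zero, ← Set.add_image_prod]
  exact (hK.prod ((convex_ball (0 : ℂ) ε).isConnected ⟨0, by simpa using hε⟩)).image _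
    continuous_add.continuousOn

/-- A continuum need not be path connected, but its open thickenings are. The path is continued by
constants, so that a difference of two paths is defined on the whole plane. -/
theorem exists_path_thickening {K : Set ℂ} (hK : IsConnected K) {ε : ℝ} (hε : 0 < ε) {p q : ℂ}
    (hp : p ∈ K) (hq : q ∈ K) :
    ∃ γ : C(ℝ, ℂ), γ 0 = p ∧ γ 1 = q ∧ ∀ t, γ t ∈ thickening ε K := by
  have h : IsPathConnected (thickening ε K) :=
    (isOpen_thickening.isConnected_iff_isPathConnected).1 (isConnected_thickening hK hε)
  obtain ⟨γ, hγ⟩ := h.joinedIn p (self_subset_thickening hε _ hp) q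
    (self_subset_thickening hε _ hq)
  refine ⟨γ.extend, by simp, by simp, fun t ↦ ?_⟩
  obtain ⟨s, hs⟩ : γ.extend t ∈ range γ := by
    rw [← γ.extend_range]
    exact mem_range_self _
  rw [← hs]
  exact hγ s

/-- A continuum over the real axis, through `0` and `1` but not through some point between them,
meets its translates by the vectors just above that point. -/
theorem interior_sub_nonempty_of_edge {K : Set ℂ} (hKc : IsCompact K) (hK : IsConnected K)
    (him : ∀ z ∈ K, 0 ≤ z.im) (h0 : 0 ∈ K) (h1 : 1 ∈ K) {c : ℝ} (hc0 : 0 < c) (hc1 : c < 1)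
    (hc : (c : ℂ) ∉ K) : (interior (K - K)).Nonempty := by
  obtain ⟨r, hr, hball⟩ : ∃ r > 0, ball (c : ℂ) r ⊆ Kᶜ :=
    Metric.isOpen_iff.1 hKc.isClosed.isOpen_compl _ hc
  have hrc : r ≤ c := by
    by_contra! h
    exact hball (by simpa [abs_of_pos hc0] using h) h0
  have hrc1 : r ≤ 1 - c := by
    by_contra! h
    refine hball ?_ h1
    rw [mem_ball, dist_eq_norm]
    have : (1 : ℂ) - c = ((1 - c : ℝ) : ℂ) := by push_cast; rfl
    rw [this, Complex.norm_real, Real.norm_of_nonneg (by linarith)]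
    exact h
  -- With radius `r / 4`, a point of `K` that is `r / 4`-close to the vertical ray below such an `x`
  -- would lie in `ball c r`, which `K` avoids.
  have hopen : IsOpen (ball (c : ℂ) (r / 4) ∩ {z | 0 < z.im}) :=
    isOpen_ball.inter (isOpen_lt continuous_const Complex.continuous_im)
  suffices hsub : ball (c : ℂ) (r / 4) ∩ {z | 0 < z.im} ⊆ K - K by
    refine Set.Nonempty.mono (interior_maximal hsub hopen) ⟨c + (r / 8 : ℝ) * Complex.I, ?_, ?_⟩
    · rw [mem_ball, dist_eq_norm, add_sub_cancel_left, norm_mul, Complex.norm_I, mul_one,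
        Complex.norm_real, Real.norm_of_nonneg (by positivity)]
      linarith
    · simp only [mem_ofPred_eq, Complex.add_im, Complex.ofReal_im, Complex.mul_im,
        Complex.ofReal_re, Complex.I_im, mul_one, Complex.I_re, mul_zero, add_zero, zero_add]
      linarith
  rintro x ⟨hxb, hx : 0 < x.im⟩
  rw [mem_ball, dist_eq_norm] at hxb
  have hxre : |x.re - c| < r / 4 := by
    have := Complex.abs_re_le_norm (x - c)
    simp only [Complex.sub_re, Complex.ofReal_re] at this
    linarith
  have hxim : x.im < r / 4 := by
    have := Complex.abs_im_le_norm (x - c)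
    simp only [Complex.sub_im, Complex.ofReal_im, sub_zero] at this
    linarith [le_abs_self x.im]
  rw [abs_lt] at hxre
  by_contra hx_not
  have hdisj : Disjoint K ((x + ·) '' K) := by
    rw [Set.disjoint_left]
    rintro _ hz ⟨w, hw, rfl⟩
    exact hx_not ⟨_, hz, w, hw, by simp⟩
  have hK'c : IsCompact ((x + ·) '' K) := hKc.image (by fun_prop)
  have hK' : IsConnected ((x + ·) '' K) := hK.image _ (by fun_prop)
  obtain ⟨ε₀, hε₀, hth₀⟩ := hdisj.exists_thickenings hKc hK'c.isClosed
  -- The bound by `x.im` keeps the path near `x + K` above the real axis, and the path near `K`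
  -- below the top point of `x + K`.
  set ε := min ε₀ x.im with hεdef
  have hε : 0 < ε := lt_min hε₀ hx
  have hεx : ε ≤ x.im := min_le_right _ _
  have hth : Disjoint (thickening ε K) (thickening ε ((x + ·) '' K)) :=
    hth₀.mono (thickening_mono (min_le_left _ _) _) (thickening_mono (min_le_left _ _) _)
  obtain ⟨t, htK, htmax⟩ := hKc.exists_isMaxOn ⟨0, h0⟩ Complex.continuous_im.continuousOn
  obtain ⟨γ, hγ0, hγ1, hγ⟩ := exists_path_thickening hK hε h0 h1
  obtain ⟨η, hη0, hη1, hη⟩ := exists_path_thickening hK' hε (p := x) (q := x + t)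
    ⟨0, h0, by simp⟩ ⟨t, htK, rfl⟩
  have hγim : ∀ s, (γ s).im < t.im + ε := by
    intro s
    obtain ⟨z, hz, hd⟩ := mem_thickening_iff.1 (hγ s)
    rw [dist_eq_norm] at hd
    have h2 := (le_abs_self _).trans (Complex.abs_im_le_norm (γ s - z))
    have h3 : z.im ≤ t.im := htmax hz
    simp only [Complex.sub_im] at h2
    linarith
  have hηim : ∀ s, 0 < (η s).im := by
    intro s
    obtain ⟨_, ⟨z, hz, rfl⟩, hd⟩ := mem_thickening_iff.1 (hη s)
    rw [dist_eq_norm] at hd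
    have h2 := (neg_abs_le _).trans' (neg_le_neg (Complex.abs_im_le_norm (η s - (x + z))))
    have h3 := him z hz
    simp only [Complex.sub_im, Complex.add_im] at h2
    linarith
  have hbot : ∀ s, ¬ ((x - γ s).re = 0 ∧ 0 ≤ (x - γ s).im) := by
    rintro s ⟨hre, him'⟩
    obtain ⟨z, hz, hd⟩ := mem_thickening_iff.1 (hγ s)
    rw [dist_eq_norm] at hd
    refine hball ?_ hz
    simp only [Complex.sub_re, Complex.sub_im] at hre him'
    have h1 := (le_abs_self _).trans (Complex.abs_im_le_norm (γ s - z))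
    have h2 := (neg_abs_le _).trans' (neg_le_neg (Complex.abs_im_le_norm (γ s - z)))
    have h3 := abs_le.1 (Complex.abs_re_le_norm (γ s - z))
    simp only [Complex.sub_im, Complex.sub_re] at h1 h2 h3
    have hz0 := him z hz
    rw [mem_ball, dist_eq_norm]
    refine (Complex.norm_le_abs_re_add_abs_im _).trans_lt ?_
    simp only [Complex.sub_re, Complex.sub_im, Complex.ofReal_re, Complex.ofReal_im, sub_zero]
    rw [abs_of_nonneg hz0]
    have h4 : |z.re - c| < r / 2 := by
      rw [abs_lt]
      constructor <;> linarith [h3.1, h3.2]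
    linarith
  -- The path from `0` to `1` near `K` separates `x` from the top of `x + K`: a zero of the
  -- difference is a common point of the two disjoint thickenings.
  obtain ⟨⟨s, s'⟩, hs⟩ := exists_eq_zero_of_boundary (F := fun p ↦ η p.2 - γ p.1) (by fun_prop)
    (fun s _ ↦ by simpa [hγ0] using hηim s) (fun s _ ↦ by simpa [hγ1] using hηim s)
    (fun s _ ↦ by
      have := hγim s
      simp only [hη1, Complex.sub_im, Complex.add_im]
      linarith)
    (fun s _ ↦ by simpa [hη0] using hbot s)
    (by
      simp only [hη0, hγ0, sub_zero]
      linarith [hxre.1])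
    (by
      simp only [hη0, hγ1, Complex.sub_re, Complex.one_re]
      linarith [hxre.2])
  have hs' : η s' = γ s := sub_eq_zero.1 hs
  exact Set.disjoint_left.1 hth (hγ s) (hs' ▸ hη s')

/-- A compact subset of the upper half plane which avoids `0` but whose closed convex hull does not
has a point on the negative real axis. -/
theorem exists_neg_of_zero_mem_closedConvexHull {K : Set ℂ} (hKc : IsCompact K)
    (him : ∀ z ∈ K, 0 ≤ z.im) (h0 : (0 : ℂ) ∉ K) (hhull : (0 : ℂ) ∈ closure (convexHull ℝ K)) :
    ∃ p ∈ K, p.im = 0 ∧ p.re < 0 := by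
  by_contra! hno
  have hKne : K.Nonempty := by
    rw [nonempty_iff_ne_empty]
    rintro rfl
    simp at hhull
  have him' : ∀ z ∈ K, z.re ≤ 0 → 0 < z.im := by
    intro z hz hre
    refine lt_of_le_of_ne (him z hz) fun h ↦ h0 ?_
    have : z = 0 := Complex.ext (le_antisymm hre (hno z hz h.symm)) h.symm
    exact this ▸ hz
  -- By compactness the points of `K` with nonpositive real part have height bounded below, so a
  -- slightly tilted line separates `0` strictly from `K`, hence from its hull.
  obtain ⟨M, hM⟩ : ∃ M : ℝ, ∀ z ∈ K, 0 < z.re + M * z.im := by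
    obtain ⟨B, hB⟩ := hKc.isBounded.exists_norm_le
    have hcl : IsCompact (K ∩ {z | z.re ≤ 0}) :=
      hKc.inter_right (isClosed_le Complex.continuous_re continuous_const)
    rcases (K ∩ {z | z.re ≤ 0}).eq_empty_or_nonempty with he | hne
    · refine ⟨0, fun z hz ↦ ?_⟩
      by_contra! h
      have : z ∈ K ∩ {z | z.re ≤ 0} := ⟨hz, by simpa using h⟩
      simp [he] at this
    · obtain ⟨w, ⟨hwK, hw⟩, hwmin⟩ := hcl.exists_isMinOn hne Complex.continuous_im.continuousOn
      have hw0 := him' w hwK hw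
      have hB0 : 0 ≤ B := (norm_nonneg _).trans (hB w hwK)
      refine ⟨(B + 1) / w.im, fun z hz ↦ ?_⟩
      by_cases hz0 : z.re ≤ 0
      · have h1 : w.im ≤ z.im := hwmin ⟨hz, hz0⟩
        have h2 : B + 1 ≤ (B + 1) / w.im * z.im := by
          rw [div_mul_eq_mul_div, le_div_iff₀ hw0]
          exact mul_le_mul_of_nonneg_left h1 (by positivity)
        have h3 := (abs_le.1 ((Complex.abs_re_le_norm z).trans (hB z hz))).1
        linarith
      · have := him z hz
        have : 0 ≤ (B + 1) / w.im * z.im := by positivity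
        linarith
  have hcont : Continuous fun z : ℂ ↦ z.re + M * z.im := by fun_prop
  obtain ⟨w, hwK, hwmin⟩ := hKc.exists_isMinOn hKne hcont.continuousOn
  have hconv : Convex ℝ {z : ℂ | w.re + M * w.im ≤ z.re + M * z.im} := by
    refine convex_halfSpace_ge ⟨fun x y ↦ ?_, fun r x ↦ ?_⟩ _
    · simp only [Complex.add_re, Complex.add_im]
      ring
    · simp only [Complex.smul_re, Complex.smul_im, smul_eq_mul]
      ring
  have hsub : closure (convexHull ℝ K) ⊆ {z : ℂ | w.re + M * w.im ≤ z.re + M * z.im} :=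
    closure_minimal (convexHull_min (fun z hz ↦ hwmin hz) hconv)
      (isClosed_le continuous_const hcont)
  have h1 : w.re + M * w.im ≤ (0 : ℂ).re + M * (0 : ℂ).im := hsub hhull
  have h2 := hM w hwK
  simp only [Complex.zero_re, Complex.zero_im, mul_zero, add_zero] at h1
  linarith

/-- Mirror image of the preceding result under `z ↦ -conj z`. -/
theorem exists_pos_of_zero_mem_closedConvexHull {K : Set ℂ} (hKc : IsCompact K)
    (him : ∀ z ∈ K, 0 ≤ z.im) (h0 : (0 : ℂ) ∉ K) (hhull : (0 : ℂ) ∈ closure (convexHull ℝ K)) :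
    ∃ p ∈ K, p.im = 0 ∧ 0 < p.re := by
  let L : ℂ →L[ℝ] ℂ := -(Complex.conjCLE : ℂ →L[ℝ] ℂ)
  have hL : ∀ z, L z = -(starRingEnd ℂ) z := fun z ↦ rfl
  obtain ⟨_, ⟨p, hp, rfl⟩, him0, hre⟩ := exists_neg_of_zero_mem_closedConvexHull
    (K := L '' K) (hKc.image L.continuous)
    (by rintro _ ⟨z, hz, rfl⟩; simpa [hL] using him z hz)
    (by
      rintro ⟨z, hz, hz0⟩
      have : z = 0 := by simpa [hL] using hz0
      exact h0 (this ▸ hz))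
    (by
      have h := image_closure_subset_closure_image L.continuous (mem_image_of_mem L hhull)
      rw [map_zero] at h
      have himg : L '' convexHull ℝ K = convexHull ℝ (L '' K) :=
        (L : ℂ →ₗ[ℝ] ℂ).image_convexHull K
      rwa [himg] at h)
  exact ⟨p, hp, by simpa [hL] using him0, by simpa [hL] using hre⟩

theorem interior_sub_nonempty_of_image {K : Set ℂ} {α β : ℂ} (hα : α ≠ 0)
    (h : (interior (((fun z ↦ α * z + β) '' K) - ((fun z ↦ α * z + β) '' K))).Nonempty) :
    (interior (K - K)).Nonempty := by
  have heq : ((fun z ↦ α * z + β) '' K) - ((fun z ↦ α * z + β) '' K) = (α * ·) '' (K - K) := by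
    ext x
    constructor
    · rintro ⟨_, ⟨z, hz, rfl⟩, _, ⟨w, hw, rfl⟩, rfl⟩
      exact ⟨z - w, ⟨z, hz, w, hw, rfl⟩, by simp only; ring⟩
    · rintro ⟨_, ⟨z, hz, w, hw, rfl⟩, rfl⟩
      exact ⟨_, ⟨z, hz, rfl⟩, _, ⟨w, hw, rfl⟩, by simp only; ring⟩
  rw [heq] at h
  have := (Homeomorph.mulLeft₀ α hα).image_interior (K - K)
  rw [Homeomorph.coe_mulLeft₀] at this
  rw [← this] at h
  exact h.of_image

theorem interior_sub_nonempty_of_frontier_subset {K : Set ℂ} (hK : IsConnected K)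
    (hKc : IsCompact K) (hint : (interior (closure (convexHull ℝ K))).Nonempty)
    (hfr : frontier (closure (convexHull ℝ K)) ⊆ K) : (interior (K - K)).Nonempty := by
  set C := closure (convexHull ℝ K) with hC
  have hKC : K ⊆ C := (subset_convexHull ℝ K).trans subset_closure
  obtain ⟨k₀, hk₀⟩ := hK.nonempty
  set O : Set ℂ := (k₀ + ·) ⁻¹' interior C ∩ {0}ᶜ with hO
  have hOo : IsOpen O :=
    (isOpen_interior.preimage (by fun_prop)).inter isOpen_compl_singleton
  have hOne : O.Nonempty := by
    refine (dense_compl_singleton (0 : ℂ)).inter_open_nonempty _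
      (isOpen_interior.preimage (by fun_prop)) ?_
    obtain ⟨c, hc⟩ := hint
    exact ⟨c - k₀, by simpa using hc⟩
  refine hOne.mono (interior_maximal ?_ hOo)
  rintro x ⟨hx : k₀ + x ∈ interior C, hx0 : x ≠ 0⟩
  have hK' : IsConnected ((x + ·) '' K) := hK.image _ (by fun_prop)
  by_contra hnot
  have hdisj : ∀ z ∈ (x + ·) '' K, z ∉ frontier C := by
    rintro _ ⟨z, hz, rfl⟩ hzf
    exact hnot ⟨_, hfr hzf, z, hz, by simp⟩
  -- The translate is connected, avoids the frontier of `C` and has the interior point `x + k₀`.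
  have hsub : (x + ·) '' K ⊆ interior C := by
    refine hK'.isPreconnected.subset_left_of_subset_union isOpen_interior
      (isClosed_closure (s := convexHull ℝ K)).isOpen_compl ?_ ?_ ⟨x + k₀, ⟨k₀, hk₀, rfl⟩, by
        rwa [add_comm]⟩
    · exact disjoint_compl_right.mono_left interior_subset
    · intro z hz
      by_cases hzC : z ∈ C
      · left
        by_contra hzi
        exact hdisj z hz ⟨subset_closure hzC, hzi⟩
      · exact Or.inr hzC
  -- The point of `K` that is farthest in the direction of `x` leaves `C` when translated by `x`.
  have hcont : Continuous fun z : ℂ ↦ z.re * x.re + z.im * x.im := by fun_prop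
  obtain ⟨t, htK, htmax⟩ := hKc.exists_isMaxOn hK.nonempty hcont.continuousOn
  have hconv : Convex ℝ {z : ℂ | z.re * x.re + z.im * x.im ≤ t.re * x.re + t.im * x.im} := by
    refine convex_halfSpace_le ⟨fun z y ↦ ?_, fun r y ↦ ?_⟩ _
    · simp only [Complex.add_re, Complex.add_im]
      ring
    · simp only [Complex.smul_re, Complex.smul_im, smul_eq_mul]
      ring
  have hCsub : C ⊆ {z : ℂ | z.re * x.re + z.im * x.im ≤ t.re * x.re + t.im * x.im} :=
    closure_minimal (convexHull_min (fun z hz ↦ htmax hz) hconv)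
      (isClosed_le hcont continuous_const)
  have h1 : (x + t).re * x.re + (x + t).im * x.im ≤ t.re * x.re + t.im * x.im :=
    hCsub (interior_subset (hsub ⟨t, htK, rfl⟩))
  simp only [Complex.add_re, Complex.add_im] at h1
  have h2 : 0 < Complex.normSq x := Complex.normSq_pos.2 hx0
  rw [Complex.normSq_apply] at h2
  linarith

theorem interior_sub_nonempty_of_frontier_not_subset {K : Set ℂ} (hK : IsConnected K)
    (hKc : IsCompact K) (hint : (interior (closure (convexHull ℝ K))).Nonempty)
    {m : ℂ} (hmf : m ∈ frontier (closure (convexHull ℝ K))) (hmK : m ∉ K) :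
    (interior (K - K)).Nonempty := by
  have hCconv : Convex ℝ (closure (convexHull ℝ K)) := (convex_convexHull ℝ K).closure
  obtain ⟨f, hf⟩ := geometric_hahn_banach_open_point hCconv.interior isOpen_interior hmf.2
  have hfle : ∀ z ∈ K, f z ≤ f m := by
    have hcl : closure (interior (closure (convexHull ℝ K))) ⊆ {z | f z ≤ f m} :=
      closure_minimal (fun z hz ↦ (hf z hz).le) (isClosed_le f.continuous continuous_const)
    rw [hCconv.closure_interior_eq_closure_of_nonempty_interior hint, closure_closure] at hcl
    exact fun z hz ↦ hcl (subset_closure (subset_convexHull ℝ K hz))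
  have hfz : ∀ z : ℂ, f z = z.re * f 1 + z.im * f Complex.I := fun z ↦ by
    conv_lhs => rw [show z = z.re • (1 : ℂ) + z.im • Complex.I by
      simp [Complex.re_add_im]]
    rw [map_add, map_smul, map_smul, smul_eq_mul, smul_eq_mul]
  -- Multiplication by `w` turns the supporting line into a horizontal one, with `K` above it.
  set w : ℂ := ⟨-f Complex.I, -f 1⟩ with hw
  have hwim : ∀ z : ℂ, (w * z).im = -f z := fun z ↦ by
    rw [hfz, Complex.mul_im, hw]
    ring
  have hw0 : w ≠ 0 := by
    intro h0
    obtain ⟨c, hc⟩ := hint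
    have h1 := hwim c
    have h2 := hwim m
    rw [h0, zero_mul, Complex.zero_im] at h1 h2
    have := hf c hc
    linarith
  set T : ℂ → ℂ := fun z ↦ w * z + -(w * m) with hT
  have hTc : Continuous T := by fun_prop
  have hT0 : T m = 0 := by simp [hT]
  have hTim : ∀ z ∈ T '' K, 0 ≤ z.im := by
    rintro _ ⟨z, hz, rfl⟩
    rw [hT]
    simp only [Complex.add_im, Complex.neg_im, hwim]
    linarith [hfle z hz]
  have hTK : (0 : ℂ) ∉ T '' K := by
    rintro ⟨z, hz, hz0⟩
    have h1 : w * (z - m) = 0 := by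
      rw [← hz0]
      simp only [hT]
      ring
    have h2 := (mul_eq_zero.1 h1).resolve_left hw0
    exact hmK (sub_eq_zero.1 h2 ▸ hz)
  have hThull : (0 : ℂ) ∈ closure (convexHull ℝ (T '' K)) := by
    let L : ℂ →ᵃ[ℝ] ℂ := (LinearMap.mulLeft ℝ w).toAffineMap + AffineMap.const ℝ ℂ (-(w * m))
    have hLT : ⇑L = T := rfl
    have himg : T '' convexHull ℝ K = convexHull ℝ (T '' K) := by
      rw [← hLT]
      exact L.image_convexHull K
    have hmC : m ∈ closure (convexHull ℝ K) := by
      have := hmf.1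
      rwa [closure_closure] at this
    have h := image_closure_subset_closure_image hTc (mem_image_of_mem T hmC)
    rwa [hT0, himg] at h
  have hTKc : IsCompact (T '' K) := hKc.image hTc
  obtain ⟨p, hpK, hpim, hpre⟩ := exists_neg_of_zero_mem_closedConvexHull hTKc hTim hTK hThull
  obtain ⟨q, hqK, hqim, hqre⟩ := exists_pos_of_zero_mem_closedConvexHull hTKc hTim hTK hThull
  set D : ℝ := q.re - p.re with hDdef
  have hD : 0 < D := by linarith
  have hp : p = (p.re : ℂ) := Complex.ext rfl hpim
  have hq : q = (q.re : ℂ) := Complex.ext rfl hqim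
  have hDc : ((D⁻¹ : ℝ) : ℂ) ≠ 0 := by simpa using hD.ne'
  -- `S` sends `p` to `0`, `q` to `1`, and the missing point `0` strictly between them.
  set S : ℂ → ℂ := fun z ↦ ((D⁻¹ : ℝ) : ℂ) * z + ((-(D⁻¹ * p.re) : ℝ) : ℂ) with hS
  have hSc : Continuous S := by fun_prop
  have hSinj : Function.Injective S := fun x y h ↦ mul_left_cancel₀ hDc (add_right_cancel h)
  have hTw : (interior (T '' K - T '' K)).Nonempty := by
    refine interior_sub_nonempty_of_image hDc (β := ((-(D⁻¹ * p.re) : ℝ) : ℂ)) ?_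
    refine interior_sub_nonempty_of_edge (K := S '' (T '' K)) (c := -(D⁻¹ * p.re))
      (hTKc.image hSc) ((hK.image T hTc.continuousOn).image S hSc.continuousOn)
      ?_ ⟨p, hpK, ?_⟩ ⟨q, hqK, ?_⟩ ?_ ?_ ?_
    · rintro _ ⟨z, hz, rfl⟩
      simp only [hS, Complex.add_im, Complex.ofReal_im, Complex.im_ofReal_mul, add_zero]
      have := hTim z hz
      positivity
    · rw [hS, hp]
      simp only [Complex.ofReal_re]
      push_cast
      ring
    · have hDq : D⁻¹ * q.re + -(D⁻¹ * p.re) = 1 := by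
        rw [← sub_eq_add_neg, ← mul_sub]
        exact inv_mul_cancel₀ hD.ne'
      have : S q = ((D⁻¹ * q.re + -(D⁻¹ * p.re) : ℝ) : ℂ) := by
        rw [hS]
        conv_lhs => rw [hq]
        push_cast
        simp
      rw [this, hDq, Complex.ofReal_one]
    · have : D⁻¹ * p.re < 0 := mul_neg_of_pos_of_neg (by positivity) hpre
      linarith
    · rw [← mul_neg, inv_mul_lt_iff₀ hD]
      linarith
    · rintro ⟨z, hz, hz0⟩
      have : S z = S 0 := by
        rw [hz0]
        simp [hS]
      exact hTK (hSinj this ▸ hz)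
  exact interior_sub_nonempty_of_image hw0 hTw

/-- The difference set of a planar continuum that does not lie on a line has interior points. -/
theorem interior_sub_nonempty {K : Set ℂ} (hKc : IsCompact K) (hK : IsConnected K)
    (hcol : ¬ Collinear ℝ K) : (interior (K - K)).Nonempty := by
  have hspan : affineSpan ℝ K = ⊤ := by
    rw [AffineSubspace.affineSpan_eq_top_iff_vectorSpan_eq_top_of_nonempty ℝ ℂ ℂ hK.nonempty]
    apply Submodule.eq_top_of_finrank_eq
    rw [collinear_iff_finrank_le_one, not_le] at hcol
    have := Submodule.finrank_le (vectorSpan ℝ K)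
    rw [Complex.finrank_real_complex] at this ⊢
    omega
  have hint : (interior (closure (convexHull ℝ K))).Nonempty :=
    (interior_convexHull_nonempty_iff_affineSpan_eq_top.2 hspan).mono
      (interior_mono subset_closure)
  by_cases hfr : frontier (closure (convexHull ℝ K)) ⊆ K
  · exact interior_sub_nonempty_of_frontier_subset hK hKc hint hfr
  · obtain ⟨m, hmf, hmK⟩ := not_subset.1 hfr
    exact interior_sub_nonempty_of_frontier_not_subset hK hKc hint hmf hmK

/-- A nondegenerate continuum on a line is a segment. -/
theorem eq_segment_of_collinear {K : Set ℂ} (hKc : IsCompact K) (hK : IsConnected K)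
    (hne : K.Nontrivial) (hcol : Collinear ℝ K) : ∃ z w : ℂ, z ≠ w ∧ K = segment ℝ z w := by
  obtain ⟨p, hp⟩ := hK.nonempty
  obtain ⟨v, hv⟩ := (collinear_iff_of_mem hp).1 hcol
  have hv0 : v ≠ 0 := by
    rintro rfl
    obtain ⟨x, hx, y, hy, hxy⟩ := hne
    obtain ⟨r, hr⟩ := hv x hx
    obtain ⟨s, hs⟩ := hv y hy
    simp only [smul_zero] at hr hs
    exact hxy (hr.trans hs.symm)
  set g : ℂ → ℝ := fun z ↦ ((z - p) / v).re with hg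
  have hgc : Continuous g := by fun_prop
  have hgl : ∀ r : ℝ, g (r • v +ᵥ p) = r := fun r ↦ by
    simp only [hg, vadd_eq_add, add_sub_cancel_right, Complex.real_smul]
    rw [mul_div_cancel_right₀ _ hv0, Complex.ofReal_re]
  have hgr : ∀ z ∈ K, g z • v +ᵥ p = z := fun z hz ↦ by
    obtain ⟨r, hr⟩ := hv z hz
    rw [hr, hgl]
  have hI := eq_Icc_of_connected_compact (hK.image g hgc.continuousOn) (hKc.image hgc)
  set s := sInf (g '' K)
  set t := sSup (g '' K)
  have hst : s ≤ t := by
    have : g p ∈ Icc s t := hI ▸ mem_image_of_mem g hp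
    exact this.1.trans this.2
  have hKI : K = AffineMap.lineMap p (v + p) '' Icc s t := by
    have hline : ∀ r : ℝ, AffineMap.lineMap p (v + p) r = r • v +ᵥ p := fun r ↦ by
      simp [AffineMap.lineMap_apply]
    ext z
    constructor
    · intro hz
      exact ⟨g z, hI ▸ mem_image_of_mem g hz, by rw [hline, hgr z hz]⟩
    · rintro ⟨r, hr, rfl⟩
      rw [← hI] at hr
      obtain ⟨z, hz, rfl⟩ := hr
      rw [hline, hgr z hz]
      exact hz
  rw [← segment_eq_Icc hst, image_segment] at hKI
  refine ⟨_, _, fun h ↦ ?_, hKI⟩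
  rw [h, segment_same] at hKI
  rw [hKI] at hne
  exact not_nontrivial_singleton hne

end PlanarContinuum

namespace FlatTorus

open Topology Metric
open scoped Pointwise

/-! ### Affine maps of the torus -/

section Affine

variable {ω a b : ℂ} {A : Torus ω → Torus ω}

theorem iterate_affine_sub (a b z w : ℂ) (n : ℕ) :
    (fun z ↦ a * z + b)^[n] z - (fun z ↦ a * z + b)^[n] w = a ^ n * (z - w) := by
  induction n with
  | zero => simp
  | succ n ih =>
    rw [Function.iterate_succ_apply', Function.iterate_succ_apply', pow_succ', mul_assoc, ← ih]
    ring

theorem iterate_affine_eq (a b z : ℂ) (n : ℕ) :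
    (fun z ↦ a * z + b)^[n] z = a ^ n * z + (fun z ↦ a * z + b)^[n] 0 := by
  have := iterate_affine_sub a b z 0 n
  rw [sub_zero] at this
  rw [← this]
  ring

theorem IsAffine.iterate_proj (hA : IsAffine ω a b A) (n : ℕ) (z : ℂ) :
    A^[n] (proj ω z) = proj ω ((fun z ↦ a * z + b)^[n] z) := by
  induction n with
  | zero => rfl
  | succ n ih => rw [Function.iterate_succ_apply', Function.iterate_succ_apply', ih, hA]

theorem IsAffine.iterate_image_proj (hA : IsAffine ω a b A) (n : ℕ) (K : Set ℂ) :
    A^[n] '' (proj ω '' K) = proj ω '' ((fun z ↦ a * z + b)^[n] '' K) := by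
  rw [image_image, image_image]
  exact image_congr fun z _ ↦ hA.iterate_proj n z

theorem IsAffine.mul_mem_lattice (hA : IsAffine ω a b A) {l : ℂ} (hl : l ∈ lattice ω) :
    a * l ∈ lattice ω := by
  have h1 : proj ω l = proj ω 0 := by simpa using proj_add_mem (z := 0) hl
  have h2 : proj ω (a * 0 + b) = proj ω (a * l + b) := by rw [← hA, ← hA, h1]
  rw [proj_eq_proj_iff] at h2
  simpa using h2

theorem IsAffine.pow_mul_mem_lattice (hA : IsAffine ω a b A) {l : ℂ} (hl : l ∈ lattice ω) (n : ℕ) :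
    a ^ n * l ∈ lattice ω := by
  induction n with
  | zero => simpa
  | succ n ih =>
    rw [pow_succ', mul_assoc]
    exact hA.mul_mem_lattice ih

/-- An affine covering of degree at least two is expanding. -/
theorem IsAffine.one_lt_norm (hω : 0 < ω.im) (hA : IsAffine ω a b A) {d : ℕ} (hd : 2 ≤ d)
    (hcov : IsCoveringOfDegree A d) : 1 < ‖a‖ := by
  have ha : a ≠ 0 := by
    rintro rfl
    obtain ⟨δ, hδ, h⟩ := exists_le_norm_of_mem_lattice hω
    -- For `a = 0` the map is constant, and `δ / 2` is too short to be a lattice vector, so this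
    -- fibre is empty.
    have hcard := (hcov.2 (proj ω (b + (δ / 2 : ℝ)))).2
    obtain ⟨x, hx⟩ : (A ⁻¹' {proj ω (b + (δ / 2 : ℝ))}).Nonempty :=
      nonempty_of_ncard_ne_zero (by omega)
    obtain ⟨z, rfl⟩ := proj_surjective x
    have h1 : proj ω (0 * z + b) = proj ω (b + (δ / 2 : ℝ)) := (hA z).symm.trans hx
    rw [proj_eq_proj_iff] at h1
    have h2 : b + ((δ / 2 : ℝ) : ℂ) - (0 * z + b) = ((δ / 2 : ℝ) : ℂ) := by ring
    rw [h2] at h1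
    have h3 := h _ h1 (by exact_mod_cast (half_pos hδ).ne')
    rw [Complex.norm_real, Real.norm_of_nonneg (half_pos hδ).le] at h3
    linarith
  by_contra! hle
  -- If `‖a‖ ≤ 1`, all powers of `a` are lattice points of the unit disc, so `a` is a root of unity.
  -- Multiplication by a power of `a` then inverts that by `a` on the lattice, and `A` is injective.
  have hfin : (closedBall (0 : ℂ) 1 ∩ (lattice ω : Set ℂ)).Finite :=
    finite_isBounded_inter_isClosed (isDiscrete_lattice hω) isBounded_closedBall
      (isClosed_lattice hω)
  obtain ⟨m, -, n, -, hmn, heq⟩ := infinite_univ.exists_ne_map_eq_of_mapsTo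
    (f := fun n : ℕ ↦ a ^ n) (t := closedBall (0 : ℂ) 1 ∩ (lattice ω : Set ℂ))
    (fun n _ ↦ ⟨by simpa using pow_le_one₀ (norm_nonneg a) hle, by
      simpa using hA.pow_mul_mem_lattice one_mem_lattice n⟩) hfin
  obtain ⟨j, hj⟩ : ∃ j : ℕ, a ^ (j + 1) = 1 := by
    wlog hlt : m < n generalizing m n
    · exact this n m hmn.symm heq.symm (by omega)
    refine ⟨n - m - 1, ?_⟩
    have : n = m + (n - m - 1 + 1) := by omega
    rw [this, pow_add] at heq
    exact (mul_eq_left₀ (pow_ne_zero _ ha)).1 heq.symm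
  have hinj : Function.Injective A := by
    intro x y hxy
    obtain ⟨z, rfl⟩ := proj_surjective x
    obtain ⟨w, rfl⟩ := proj_surjective y
    rw [hA, hA, proj_eq_proj_iff] at hxy
    rw [proj_eq_proj_iff]
    have h1 := hA.pow_mul_mem_lattice hxy j
    have h2 : a ^ j * (a * w + b - (a * z + b)) = a ^ (j + 1) * (w - z) := by ring
    rwa [h2, hj, one_mul] at h1
  have h1 := (hcov.2 (proj ω 0)).2
  have h2 : (A ⁻¹' {proj ω 0}).Subsingleton := fun x hx y hy ↦
    hinj ((show A x = _ from hx).trans (show A y = _ from hy).symm)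
  have := (ncard_le_one (hcov.2 (proj ω 0)).1).2 fun x hx y hy ↦ h2 hx hy
  omega

end Affine

/-! ### Lifts of simply-connected continua -/

section Lift

variable {ω a b : ℂ} {A : Torus ω → Torus ω}

theorem exists_lift_of_isSimplyConnected (hω : 0 < ω.im) {U : Set (Torus ω)} (hUo : IsOpen U)
    (hU : IsSimplyConnected U) {z₀ : ℂ} (hz₀ : proj ω z₀ ∈ U) :
    ∃ F : C(U, ℂ), F ⟨proj ω z₀, hz₀⟩ = z₀ ∧ ∀ u, proj ω (F u) = u := by
  have := hU.simplyConnectedSpace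
  have := locallyPathConnectedSpace_torus (ω := ω)
  have := hUo.locallyPathConnectedSpace
  obtain ⟨F, ⟨hF0, hF⟩, -⟩ := (isCoveringMap_proj hω).existsUnique_continuousMap_lifts
    (⟨Subtype.val, continuous_subtype_val⟩ : C(U, Torus ω)) ⟨proj ω z₀, hz₀⟩ z₀ rfl
  exact ⟨F, hF0, fun u ↦ congr_fun hF u⟩

/-- A section of the projection over `U` that is correct at one point of `K` recovers all of `K`, by
uniqueness of lifts. -/
theorem injOn_proj_of_image_subset (hω : 0 < ω.im) {K : Set ℂ} (hK : IsPreconnected K)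
    {U : Set (Torus ω)} (hUo : IsOpen U) (hU : IsSimplyConnected U) (hKU : proj ω '' K ⊆ U) :
    InjOn (proj ω) K := by
  intro z₀ hz₀ w hw hzw
  obtain ⟨F, hF0, hF⟩ := exists_lift_of_isSimplyConnected hω hUo hU (hKU ⟨z₀, hz₀, rfl⟩)
  have : PreconnectedSpace K := isPreconnected_iff_preconnectedSpace.1 hK
  have heq := (isCoveringMap_proj hω).eq_of_comp_eq
    (g₁ := fun z : K ↦ F ⟨proj ω z, hKU ⟨z, z.2, rfl⟩⟩) (g₂ := fun z : K ↦ (z : ℂ))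
    (F.continuous.comp ((continuous_proj.comp continuous_subtype_val).subtype_mk _))
    continuous_subtype_val (funext fun z ↦ hF _) ⟨z₀, hz₀⟩ hF0
  have h1 : F ⟨proj ω w, hKU ⟨w, hw, rfl⟩⟩ = w := congr_fun heq ⟨w, hw⟩
  rw [← hF0, ← h1]
  congr 1
  exact Subtype.ext hzw

theorem isLocallyInjective_iterate {X : Type*} [TopologicalSpace X] {f : X → X}
    (hf : IsLocalHomeomorph f) (n : ℕ) : IsLocallyInjective f^[n] := by
  have : IsLocalHomeomorph f^[n] := by
    induction n with
    | zero => exact (Homeomorph.refl X).isLocalHomeomorph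
    | succ n ih => exact ih.comp hf
  exact this.isLocallyInjective

/-- An eventually simply-connected wandering continuum lifts homeomorphically to the plane, and so
do all its images of large order. -/
theorem exists_lift_of_isEventuallySCWanderingContinuum (hω : 0 < ω.im) (hA : IsAffine ω a b A)
    (ha : a ≠ 0) (hloc : IsLocalHomeomorph A) {E : Set (Torus ω)}
    (hE : IsEventuallySCWanderingContinuum A E) :
    ∃ K : Set ℂ, IsCompact K ∧ IsConnected K ∧ K.Nontrivial ∧ proj ω '' K = E ∧
      ∃ N : ℕ, ∀ n, N ≤ n → ∀ z ∈ K, ∀ w ∈ K, a ^ n * (z - w) ∈ lattice ω → z = w := by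
  obtain ⟨⟨hEc, hEconn, hEne, -⟩, N, hN⟩ := hE
  obtain ⟨-, -, U, hUo, hU, hEU, -⟩ := hN N le_rfl
  have hT2 := t2Space_torus hω
  obtain ⟨e₀, he₀⟩ := hEconn.nonempty
  obtain ⟨z₀, rfl⟩ := proj_surjective e₀
  set T : ℂ → ℂ := fun z ↦ a * z + b with hT
  have hz₀U : proj ω (T^[N] z₀) ∈ U := hEU ⟨_, he₀, hA.iterate_proj N z₀⟩
  obtain ⟨F, hF0, hF⟩ := exists_lift_of_isSimplyConnected hω hUo hU hz₀U
  have haN : a ^ N ≠ 0 := pow_ne_zero _ ha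
  -- Only the `N`-th image is known to lie in a simply-connected domain: it is lifted there and
  -- pulled back by the inverse of the affine map `T^[N]`.
  set σ : U → ℂ := fun u ↦ (F u - T^[N] 0) / a ^ N with hσ
  have hσc : Continuous σ := by fun_prop
  have hTσ : ∀ u, T^[N] (σ u) = F u := fun u ↦ by
    rw [iterate_affine_eq, hσ]
    field_simp
    simp [hT]
  have hAc : Continuous A^[N] := hloc.continuous.iterate N
  have : PreconnectedSpace E := isPreconnected_iff_preconnectedSpace.1 hEconn.isPreconnected
  have : CompactSpace E := isCompact_iff_compactSpace.1 hEc
  have : Nonempty E := hEconn.nonempty.to_subtype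
  let g : E → ℂ := fun e ↦ σ ⟨A^[N] e, hEU ⟨e, e.2, rfl⟩⟩
  have hg : Continuous g := hσc.comp ((hAc.comp continuous_subtype_val).subtype_mk _)
  have hg0 : g ⟨proj ω z₀, he₀⟩ = z₀ := by
    have h1 : T^[N] (g ⟨proj ω z₀, he₀⟩) = T^[N] z₀ := by
      rw [hTσ]
      conv_rhs => rw [← hF0]
      congr 1
      exact Subtype.ext (hA.iterate_proj N z₀)
    have h2 := iterate_affine_sub a b (g ⟨proj ω z₀, he₀⟩) z₀ N
    rw [← hT, h1, sub_self] at h2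
    exact sub_eq_zero.1 ((mul_eq_zero.1 h2.symm).resolve_left haN)
  -- Both sides agree after applying `A^[N]` and at one point; `A^[N]` is locally injective and `E`
  -- is connected.
  have hpg : ∀ e, proj ω (g e) = e := by
    have := (T2Space.isSeparatedMap A^[N]).eq_of_comp_eq (isLocallyInjective_iterate hloc N)
      (g₁ := fun e ↦ proj ω (g e)) (g₂ := fun e : E ↦ (e : Torus ω)) (continuous_proj.comp hg)
      continuous_subtype_val (funext fun e ↦ by
        simp only [Function.comp_apply]
        rw [hA.iterate_proj, ← hT, hTσ, hF]) ⟨_, he₀⟩ (by simp only [hg0])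
    exact fun e ↦ congr_fun this e
  have hKE : proj ω '' range g = E := by
    rw [← range_comp]
    have : proj ω ∘ g = Subtype.val := funext hpg
    rw [this, Subtype.range_coe]
  have hKconn : IsConnected (range g) :=
    ⟨range_nonempty g, isPreconnected_range hg⟩
  refine ⟨range g, isCompact_range hg, hKconn, ?_, hKE, N, ?_⟩
  · rw [← hKE] at hEne
    exact Set.nontrivial_of_image _ _ hEne
  · intro n hn z hz w hw hzw
    obtain ⟨-, -, V, hVo, hV, hEV, -⟩ := hN n hn
    rw [← hKE, hA.iterate_image_proj] at hEV
    have hTc : Continuous T^[n] := Continuous.iterate (by fun_prop) n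
    have hinj := injOn_proj_of_image_subset hω
      (hKconn.isPreconnected.image _ hTc.continuousOn) hVo hV hEV
    rw [← iterate_affine_sub a b, ← proj_eq_proj_iff] at hzw
    have h1 := hinj ⟨w, hw, rfl⟩ ⟨z, hz, rfl⟩ hzw
    have h2 := iterate_affine_sub a b z w n
    rw [← hT, ← h1, sub_self] at h2
    exact sub_eq_zero.1 ((mul_eq_zero.1 h2.symm).resolve_left (pow_ne_zero _ ha))

/-- The lift of an eventually simply-connected wandering continuum lies on a line, as its
difference set avoids the dense set of all `l / a ^ n` with `l ≠ 0` in the lattice. -/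
theorem collinear_of_pow_mul_sub_mem (hω : 0 < ω.im) (ha : 1 < ‖a‖) {K : Set ℂ} (hKc : IsCompact K)
    (hK : IsConnected K) {N : ℕ}
    (hN : ∀ n, N ≤ n → ∀ z ∈ K, ∀ w ∈ K, a ^ n * (z - w) ∈ lattice ω → z = w) :
    Collinear ℝ K := by
  by_contra hcol
  obtain ⟨y, hy, hy0⟩ := (dense_compl_singleton (0 : ℂ)).inter_open_nonempty _ isOpen_interior
    (PlanarContinuum.interior_sub_nonempty hKc hK hcol)
  obtain ⟨ρ, hρ, hball⟩ := Metric.isOpen_iff.1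
    (isOpen_interior.inter (isOpen_compl_singleton (x := (0 : ℂ)))) y ⟨hy, hy0⟩
  obtain ⟨R, hR⟩ := exists_mem_lattice_norm_sub_le hω
  obtain ⟨n₀, hn₀⟩ := pow_unbounded_of_one_lt (R / ρ) ha
  set n := max N n₀
  have hn : R / ρ < ‖a‖ ^ n :=
    hn₀.trans_le (pow_le_pow_right₀ ha.le (le_max_right _ _))
  have ha0 : a ^ n ≠ 0 := pow_ne_zero _ (norm_pos_iff.1 (one_pos.trans ha))
  obtain ⟨l, hl, hlR⟩ := hR (a ^ n * y)
  -- The scaled lattice is `R / ‖a‖ ^ n`-dense, which is finer than `ρ`.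
  obtain ⟨hx, hx0⟩ : l / a ^ n ∈ interior (K - K) ∩ {0}ᶜ := by
    apply hball
    rw [mem_ball, dist_comm, dist_eq_norm]
    have h1 : y - l / a ^ n = (a ^ n * y - l) / a ^ n := by field_simp
    rw [h1, norm_div, norm_pow, div_lt_iff₀ (by positivity)]
    rw [div_lt_iff₀ hρ] at hn
    linarith
  obtain ⟨z, hz, w, hw, hzw⟩ := interior_subset hx
  have hzw' : z - w = l / a ^ n := hzw
  refine hx0 ?_
  have h2 := hN n (le_max_left _ _) z hz w hw (by
    rw [hzw', mul_div_cancel₀ _ ha0]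
    exact hl)
  rw [mem_singleton_iff, ← hzw', h2, sub_self]

end Lift

/-! ### Wandering segments -/

section Segment

variable {ω a b : ℂ} {A : Torus ω → Torus ω}

theorem mem_segment_of_abs_le {z w : ℂ} {s : ℝ} (hs : |s| ≤ 1 / 2) :
    (z + w) / 2 + s * (w - z) ∈ segment ℝ z w := by
  rw [abs_le] at hs
  refine ⟨1 / 2 - s, 1 / 2 + s, by linarith, by linarith, by ring, ?_⟩
  simp only [Complex.real_smul]
  push_cast
  ring

/-- If the multiplier is not real, then the images of a segment become so long that two
consecutive ones, which are not parallel, must cross. -/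
theorem im_eq_zero_of_disjoint_iterate (hω : 0 < ω.im) (hA : IsAffine ω a b A) (ha : 1 < ‖a‖)
    {z w : ℂ} (hzw : z ≠ w)
    (hdisj : ∀ m n : ℕ, m < n →
      Disjoint (A^[m] '' (proj ω '' segment ℝ z w)) (A^[n] '' (proj ω '' segment ℝ z w))) :
    a.im = 0 := by
  by_contra him
  obtain ⟨R, hR⟩ := exists_mem_lattice_norm_sub_le hω
  set v := w - z with hv
  have hv0 : 0 < ‖v‖ := norm_pos_iff.2 (sub_ne_zero.2 hzw.symm)
  have him' : 0 < |a.im| := abs_pos.2 him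
  -- `M` dominates the solution of `s - s' * a = e` with real `s`, `s'`: both are at most `‖e‖ * M`.
  set M : ℝ := 1 / |a.im| + 1 + |a.re| / |a.im| with hM
  have hMpos : 0 < M := by positivity
  obtain ⟨n, hn⟩ := pow_unbounded_of_one_lt (R * (2 * M) / ‖v‖) ha
  rw [div_lt_iff₀ hv0] at hn
  have ha0 : a ^ n ≠ 0 := pow_ne_zero _ (norm_pos_iff.1 (one_pos.trans ha))
  have hV0 : a ^ n * v ≠ 0 := mul_ne_zero ha0 (norm_pos_iff.1 hv0)
  set c := (z + w) / 2 with hc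
  set T : ℂ → ℂ := fun z ↦ a * z + b with hT
  obtain ⟨l, hl, hlR⟩ := hR (T^[n + 1] c - T^[n] c)
  -- The points with parameters `s` and `s'`, measured from the midpoints of the two images, agree
  -- modulo `l` exactly when `s - s' * a = e`. This is solvable since `1` and `a` are independent
  -- over the reals.
  set e : ℂ := (T^[n + 1] c - T^[n] c - l) / (a ^ n * v) with he
  have henorm : ‖e‖ * (2 * M) < 1 := by
    rw [he, norm_div, norm_mul, norm_pow, div_mul_eq_mul_div, div_lt_one (by positivity)]
    exact (mul_le_mul_of_nonneg_right hlR (by positivity)).trans_lt hn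
  set s' : ℝ := -(e.im / a.im) with hs'
  set s : ℝ := e.re + s' * a.re with hs
  have hre := Complex.abs_re_le_norm e
  have him_le := Complex.abs_im_le_norm e
  have hMe : ‖e‖ * M ≤ 1 / 2 := by linarith
  have hMexp : ‖e‖ * M = ‖e‖ / |a.im| + ‖e‖ + ‖e‖ * |a.re| / |a.im| := by
    rw [hM]
    ring
  have h1 : 0 ≤ ‖e‖ / |a.im| := by positivity
  have h2 : 0 ≤ ‖e‖ * |a.re| / |a.im| := by positivity
  have h3 := norm_nonneg e
  have hs'le' : |s'| ≤ ‖e‖ / |a.im| := by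
    rw [hs', abs_neg, abs_div]
    gcongr
  have hs'le : |s'| ≤ 1 / 2 := by linarith
  have hsle : |s| ≤ 1 / 2 := by
    have h4 : |s' * a.re| ≤ ‖e‖ * |a.re| / |a.im| := by
      rw [abs_mul, mul_div_right_comm]
      gcongr
    have := abs_add_le e.re (s' * a.re)
    linarith
  have hsolve : (s : ℂ) - s' * a = e := by
    apply Complex.ext
    · simp [hs]
    · simp only [Complex.sub_im, Complex.ofReal_im, Complex.mul_im, Complex.ofReal_re, hs']
      field_simp
      ring
  refine Set.disjoint_left.1 (hdisj n (n + 1) n.lt_succ_self)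
    ⟨_, ⟨_, mem_segment_of_abs_le hsle, rfl⟩, rfl⟩
    ⟨_, ⟨_, mem_segment_of_abs_le hs'le, rfl⟩, ?_⟩
  rw [hA.iterate_proj, hA.iterate_proj, ← hT, ← hc, ← hv, proj_eq_proj_iff]
  have h5 : T^[n] (c + s * v) = T^[n] c + s * (a ^ n * v) := by
    have := iterate_affine_sub a b (c + s * v) c n
    rw [sub_eq_iff_eq_add] at this
    rw [this]
    ring
  have h6 : T^[n + 1] (c + s' * v) = T^[n + 1] c + s' * a * (a ^ n * v) := by
    have := iterate_affine_sub a b (c + s' * v) c (n + 1)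
    rw [sub_eq_iff_eq_add] at this
    rw [this]
    ring
  have h7 : ((s : ℂ) - s' * a) * (a ^ n * v) = T^[n + 1] c - T^[n] c - l := by
    rw [hsolve, he, div_mul_cancel₀ _ hV0]
  rw [h5, h6]
  have h8 : T^[n] c + s * (a ^ n * v) - (T^[n + 1] c + s' * a * (a ^ n * v)) = -l := by
    linear_combination h7
  rw [h8]
  exact neg_mem hl

theorem exists_int_of_im_eq_zero (hω : 0 < ω.im) (hA : IsAffine ω a b A) (him : a.im = 0) :
    ∃ k : ℤ, a = k := by
  obtain ⟨n, m, h⟩ := mem_lattice.1 (mul_one a ▸ hA.mul_mem_lattice one_mem_lattice)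
  have h1 := congr_arg Complex.im h
  simp only [him, Complex.add_im, Complex.intCast_im, Complex.mul_im, Complex.intCast_re, zero_mul,
    add_zero, zero_add, zero_eq_mul] at h1
  have hm : m = 0 := by exact_mod_cast h1.resolve_right hω.ne'
  exact ⟨n, by simpa [hm] using h⟩

/-- For an integer multiplier, a segment whose images all embed has irrational slope, and so lies
on an infinite geodesic. -/
theorem isLineSegmentInInfiniteGeodesic_segment (hω : 0 < ω.im) {k : ℤ} (hk : 1 < ‖(k : ℂ)‖)
    {z w : ℂ} (hzw : z ≠ w) {N : ℕ}
    (hN : ∀ n, N ≤ n → ∀ x ∈ segment ℝ z w, ∀ y ∈ segment ℝ z w,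
      (k : ℂ) ^ n * (x - y) ∈ lattice ω → x = y) :
    IsLineSegmentInInfiniteGeodesic ω (proj ω '' segment ℝ z w) := by
  refine ⟨⟨z, w, hzw, rfl⟩, ?_⟩
  set L := ‖w - z‖ with hL
  have hL0 : 0 < L := norm_pos_iff.2 (sub_ne_zero.2 hzw.symm)
  set u : ℂ := (w - z) / L with hu
  have hLc : (L : ℂ) ≠ 0 := by exact_mod_cast hL0.ne'
  have hu1 : ‖u‖ = 1 := by
    rw [hu, norm_div, Complex.norm_real, Real.norm_of_nonneg hL0.le, div_self hL0.ne']
  have hseg : segment ℝ z w = (fun t : ℝ ↦ z + t * u) '' Icc 0 L := by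
    rw [segment_eq_image']
    ext x
    constructor
    · rintro ⟨t, ht, rfl⟩
      refine ⟨t * L, ⟨mul_nonneg ht.1 hL0.le, mul_le_of_le_one_left hL0.le ht.2⟩, ?_⟩
      simp only [hu, Complex.real_smul]
      push_cast
      field_simp
    · rintro ⟨t, ht, rfl⟩
      refine ⟨t / L, ⟨div_nonneg ht.1 hL0.le, (div_le_one hL0).2 ht.2⟩, ?_⟩
      simp only [hu, Complex.real_smul]
      push_cast
      field_simp
  have hirr : ∀ r : ℝ, (r : ℂ) * u ∈ lattice ω → r = 0 := by
    intro r hr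
    by_contra hr0
    obtain ⟨n₀, hn₀⟩ := pow_unbounded_of_one_lt (|r| / L) hk
    set n := max N n₀
    have hn : |r| / L < ‖(k : ℂ)‖ ^ n :=
      hn₀.trans_le (pow_le_pow_right₀ hk.le (le_max_right _ _))
    rw [div_lt_iff₀ hL0, Complex.norm_intCast, ← abs_pow] at hn
    have hk0 : (k : ℂ) ≠ 0 := norm_pos_iff.1 (one_pos.trans hk)
    have hkn : (k : ℂ) ^ n ≠ 0 := pow_ne_zero _ hk0
    have hknr : (k : ℝ) ^ n ≠ 0 := by exact_mod_cast hkn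
    -- Dividing by a power of the integer `k` keeps the direction and makes the vector fit into the
    -- segment; its absolute value allows it to start at `z`.
    set τ : ℝ := r / (k : ℝ) ^ n with hτ
    have hτ0 : τ ≠ 0 := div_ne_zero hr0 hknr
    have hτL : |τ| ≤ L := by
      rw [hτ, abs_div, div_le_iff₀ (abs_pos.2 hknr), mul_comm]
      exact hn.le
    have hx : z + |τ| * u ∈ segment ℝ z w := by
      rw [hseg]
      exact ⟨|τ|, ⟨abs_nonneg _, hτL⟩, rfl⟩
    have hmem : (k : ℂ) ^ n * (z + |τ| * u - z) ∈ lattice ω := by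
      have h1 : (k : ℂ) ^ n * (τ * u) = r * u := by
        rw [hτ]
        push_cast
        field_simp
      rw [add_sub_cancel_left]
      rcases abs_choice τ with h | h <;> rw [h]
      · rw [h1]
        exact hr
      · push_cast
        rw [neg_mul, mul_neg, h1]
        exact neg_mem hr
    have h2 := hN n (le_max_left _ _) _ hx z (left_mem_segment ℝ z w) hmem
    have hu0 : u ≠ 0 := norm_pos_iff.1 (by rw [hu1]; exact one_pos)
    have h3 : ((|τ| : ℝ) : ℂ) * u = 0 := by simpa using h2
    have h4 := (mul_eq_zero.1 h3).resolve_right hu0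
    exact hτ0 (abs_eq_zero.1 (by exact_mod_cast h4))
  refine ⟨fun t ↦ proj ω (z + t * u), ⟨?_, ?_⟩, 0, L, hL0, ?_⟩
  · obtain ⟨δ, hδ, hgap⟩ := exists_le_norm_of_mem_lattice hω
    intro t
    refine ⟨δ / 4, by positivity, fun s hs s' hs' ↦ ?_⟩
    have h1 : ‖z + (s : ℂ) * u - (z + s' * u)‖ = dist s s' := by
      have : z + (s : ℂ) * u - (z + s' * u) = ((s - s' : ℝ) : ℂ) * u := by
        push_cast
        ring
      rw [this, norm_mul, hu1, mul_one, Complex.norm_real, Real.dist_eq, Real.norm_eq_abs]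
    have h2 : dist s s' ≤ δ / 2 := by
      have := dist_triangle_right s s' t
      rw [mem_ball] at hs hs'
      linarith
    rw [dist_proj_eq hgap (h1 ▸ h2), h1]
  · intro s s' h
    rw [proj_eq_proj_iff] at h
    have h1 : z + (s' : ℂ) * u - (z + s * u) = ((s' - s : ℝ) : ℂ) * u := by
      push_cast
      ring
    rw [h1] at h
    linarith [hirr _ h]
  · rw [hseg, image_image]

end Segment

/-! ### Existence for integer multipliers -/

section Existence

variable {ω b : ℂ} {A : Torus ω → Torus ω}

theorem convex_reProdIm {s t : Set ℝ} (hs : Convex ℝ s) (ht : Convex ℝ t) :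
    Convex ℝ (s ×ℂ t) :=
  (hs.linear_preimage Complex.reLm).inter (ht.linear_preimage Complex.imLm)

/-- An open rectangle around the interval `[0, 1]` is not disconnected by this interval. -/
theorem isConnected_reProdIm_diff_Icc {ρ : ℝ} (hρ : 0 < ρ) :
    IsConnected ((Ioo (-ρ) (1 + ρ) ×ℂ Ioo (-ρ) ρ) \ ((fun t : ℝ ↦ (t : ℂ)) '' Icc 0 1)) := by
  have hpre : ∀ p q r s : ℝ, IsPreconnected (Ioo p q ×ℂ Ioo r s) := fun p q r s ↦
    (convex_reProdIm (convex_Ioo p q) (convex_Ioo r s)).isPreconnected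
  -- The complement is a chain of overlapping rectangles: above, left, below and right of the
  -- interval.
  have heq : (Ioo (-ρ) (1 + ρ) ×ℂ Ioo (-ρ) ρ) \ ((fun t : ℝ ↦ (t : ℂ)) '' Icc 0 1) =
      ((Ioo (-ρ) (1 + ρ) ×ℂ Ioo 0 ρ ∪ Ioo (-ρ) 0 ×ℂ Ioo (-ρ) ρ) ∪
        Ioo (-ρ) (1 + ρ) ×ℂ Ioo (-ρ) 0) ∪ Ioo 1 (1 + ρ) ×ℂ Ioo (-ρ) ρ := by
    ext ζ
    have hmem : ζ ∈ (fun t : ℝ ↦ (t : ℂ)) '' Icc 0 1 ↔ ζ.im = 0 ∧ 0 ≤ ζ.re ∧ ζ.re ≤ 1 := by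
      constructor
      · rintro ⟨t, ht, rfl⟩
        exact ⟨rfl, ht⟩
      · rintro ⟨h1, h2⟩
        exact ⟨ζ.re, h2, Complex.ext rfl h1.symm⟩
    rw [mem_sdiff, hmem]
    simp only [mem_union, Complex.mem_reProdIm, mem_Ioo]
    constructor
    · rintro ⟨⟨⟨h1, h2⟩, h3, h4⟩, h5⟩
      rcases lt_trichotomy ζ.im 0 with h | h | h
      · exact Or.inl (Or.inr ⟨⟨h1, h2⟩, h3, h⟩)
      · by_cases h6 : 0 ≤ ζ.re
        · exact Or.inr ⟨⟨lt_of_not_ge fun h7 ↦ h5 ⟨h, h6, h7⟩, h2⟩, h3, h4⟩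
        · exact Or.inl (Or.inl (Or.inr ⟨⟨h1, not_le.1 h6⟩, h3, h4⟩))
      · exact Or.inl (Or.inl (Or.inl ⟨⟨h1, h2⟩, h, h4⟩))
    · rintro (((⟨⟨h1, h2⟩, h3, h4⟩ | ⟨⟨h1, h2⟩, h3, h4⟩) | ⟨⟨h1, h2⟩, h3, h4⟩) | ⟨⟨h1, h2⟩, h3, h4⟩)
      all_goals
        refine ⟨⟨⟨by linarith, by linarith⟩, by linarith, by linarith⟩, ?_⟩
        rintro ⟨h5, h6, h7⟩
        linarith
  rw [heq]
  have hm : ∀ x y : ℝ, ∀ p q r s : ℝ, p < x → x < q → r < y → y < s →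
      (⟨x, y⟩ : ℂ) ∈ Ioo p q ×ℂ Ioo r s := fun x y p q r s h1 h2 h3 h4 ↦ ⟨⟨h1, h2⟩, h3, h4⟩
  refine ⟨⟨⟨-ρ / 2, ρ / 2⟩, Or.inl (Or.inl (Or.inl (hm _ _ _ _ _ _ (by linarith) (by linarith)
    (by linarith) (by linarith))))⟩, ?_⟩
  refine IsPreconnected.union ⟨1 + ρ / 2, ρ / 2⟩
    (Or.inl (Or.inl (hm _ _ _ _ _ _ (by linarith) (by linarith) (by linarith) (by linarith))))
    (hm _ _ _ _ _ _ (by linarith) (by linarith) (by linarith) (by linarith)) ?_ (hpre _ _ _ _)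
  refine IsPreconnected.union ⟨-ρ / 2, -ρ / 2⟩
    (Or.inr (hm _ _ _ _ _ _ (by linarith) (by linarith) (by linarith) (by linarith)))
    (hm _ _ _ _ _ _ (by linarith) (by linarith) (by linarith) (by linarith)) ?_ (hpre _ _ _ _)
  exact IsPreconnected.union ⟨-ρ / 2, ρ / 2⟩
    (hm _ _ _ _ _ _ (by linarith) (by linarith) (by linarith) (by linarith))
    (hm _ _ _ _ _ _ (by linarith) (by linarith) (by linarith) (by linarith)) (hpre _ _ _ _)
    (hpre _ _ _ _)

theorem reProdIm_subset_thickening {ρ : ℝ} :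
    Ioo (-ρ) (1 + ρ) ×ℂ Ioo (-ρ) ρ ⊆ thickening (2 * ρ) ((fun t : ℝ ↦ (t : ℂ)) '' Icc 0 1) := by
  rintro ζ ⟨⟨h1, h2⟩, h3, h4⟩
  have hc : max 0 (min 1 ζ.re) ∈ Icc (0 : ℝ) 1 :=
    ⟨le_max_left _ _, max_le zero_le_one (min_le_left _ _)⟩
  refine mem_thickening_iff.2 ⟨_, ⟨_, hc, rfl⟩, ?_⟩
  rw [dist_eq_norm]
  refine (Complex.norm_le_abs_re_add_abs_im _).trans_lt ?_
  simp only [Complex.sub_re, Complex.sub_im, Complex.ofReal_re, Complex.ofReal_im, sub_zero]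
  have h5 : |ζ.im| < ρ := abs_lt.2 ⟨h3, h4⟩
  have h6 : |ζ.re - max 0 (min 1 ζ.re)| < ρ := by
    rw [abs_lt]
    rcases le_total ζ.re 0 with h | h
    · rw [min_eq_right (h.trans zero_le_one), max_eq_left h]
      constructor <;> linarith
    · rw [max_eq_right (le_min zero_le_one h)]
      rcases le_total ζ.re 1 with h' | h'
      · rw [min_eq_right h']
        constructor <;> linarith
      · rw [min_eq_left h']
        constructor <;> linarith
  linarith

theorem isSimplyConnected_image_of_injOn {X Y : Type*} [TopologicalSpace X] [TopologicalSpace Y]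
    {f : X → Y} (hfc : Continuous f) (hfo : IsOpenMap f) {V : Set X} (hVo : IsOpen V)
    (hV : IsSimplyConnected V) (hinj : InjOn f V) : IsSimplyConnected (f '' V) := by
  have hemb : IsOpenEmbedding (f ∘ (Subtype.val : V → X)) :=
    .of_continuous_injective_isOpenMap (hfc.comp continuous_subtype_val)
      (fun x y h ↦ Subtype.ext (hinj x.2 y.2 h)) (hfo.comp hVo.isOpenMap_subtype_val)
  have h1 : (Subtype.val : V → X) '' univ = V := by simp
  rw [← h1, ← image_comp, hemb.isEmbedding.isSimplyConnected_image,
    ← IsEmbedding.subtypeVal.isSimplyConnected_image, h1]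
  exact hV

/-- An embedded segment of the torus is a simply-connected continuum. -/
theorem isSimplyConnectedContinuum_segment (hω : 0 < ω.im) {z w : ℂ} (hzw : z ≠ w)
    (hinj : InjOn (proj ω) (segment ℝ z w)) :
    IsSimplyConnectedContinuum (proj ω '' segment ℝ z w) := by
  have hsegc : IsCompact (segment ℝ z w) := by
    rw [segment_eq_image']
    exact isCompact_Icc.image (by fun_prop)
  have hsegconn : IsConnected (segment ℝ z w) :=
    (convex_segment z w).isConnected ⟨z, left_mem_segment ℝ z w⟩
  refine ⟨hsegc.image continuous_proj, hsegconn.image _ continuous_proj.continuousOn, ?_⟩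
  have hT2 := t2Space_torus hω
  let φ : ℂ ≃ₜ ℂ := (Homeomorph.mulRight₀ (w - z) (sub_ne_zero.2 hzw.symm)).trans
    (Homeomorph.addLeft z)
  have hφ : ∀ ζ, φ ζ = z + ζ * (w - z) := fun ζ ↦ rfl
  set I : Set ℂ := (fun t : ℝ ↦ (t : ℂ)) '' Icc 0 1 with hI
  have hIc : IsCompact I := isCompact_Icc.image Complex.continuous_ofReal
  have hseg : segment ℝ z w = φ '' I := by
    rw [segment_eq_image', hI, image_image]
    exact image_congr fun t _ ↦ by rw [hφ, Complex.real_smul]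
  set f : ℂ → Torus ω := proj ω ∘ φ with hf
  have hfc : Continuous f := continuous_proj.comp φ.continuous
  have hfo : IsOpenMap f := isOpenMap_proj.comp φ.isOpenMap
  have hfI : InjOn f I := by
    rw [hseg] at hinj
    exact hinj.comp φ.injective.injOn (mapsTo_image _ _)
  have hfloc : IsLocallyInjective f :=
    ((isCoveringMap_proj hω).isLocalHomeomorph.comp φ.isLocalHomeomorph).isLocallyInjective
  -- A locally injective map that is injective on a compact set is injective near it.
  obtain ⟨t, hto, hIt, hft⟩ := hfI.exists_isOpen_superset hIc (fun x _ ↦ hfc.continuousAt)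
    fun x _ ↦ by
      obtain ⟨u, hu, hxu, hinju⟩ := hfloc x
      exact ⟨u, hu.mem_nhds hxu, hinju⟩
  obtain ⟨δ, hδ, hthick⟩ := hIc.exists_thickening_subset_open hto hIt
  set ρ := δ / 2 with hρdef
  have hρ : 0 < ρ := half_pos hδ
  set V := Ioo (-ρ) (1 + ρ) ×ℂ Ioo (-ρ) ρ with hV
  have hVt : V ⊆ t := by
    refine reProdIm_subset_thickening.trans ?_
    rwa [hρdef, mul_div_cancel₀ _ two_ne_zero]
  have hVo : IsOpen V := isOpen_Ioo.reProdIm isOpen_Ioo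
  have hVconv : Convex ℝ V := convex_reProdIm (convex_Ioo _ _) (convex_Ioo _ _)
  have hIV : I ⊆ V := by
    rintro _ ⟨s, hs, rfl⟩
    refine ⟨⟨?_, ?_⟩, ?_, ?_⟩
    · rw [Complex.ofReal_re]
      linarith [hs.1]
    · rw [Complex.ofReal_re]
      linarith [hs.2]
    · rw [Complex.ofReal_im]
      linarith
    · rwa [Complex.ofReal_im]
  have hfV : InjOn f V := hft.mono hVt
  have hEf : proj ω '' segment ℝ z w = f '' I := by
    rw [hseg, hf, image_comp]
  refine ⟨f '' V, hfo V hVo, ?_, ?_, ?_⟩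
  · refine isSimplyConnected_image_of_injOn hfc hfo hVo ?_ hfV
    have : ContractibleSpace V :=
      hVconv.contractibleSpace ⟨_, hIV ⟨0, ⟨le_rfl, zero_le_one⟩, rfl⟩⟩
    exact SimplyConnectedSpace.ofContractible V
  · rw [hEf]
    exact image_mono hIV
  · rw [hEf, ← hfV.image_sdiff_subset hIV]
    exact (isConnected_reProdIm_diff_Icc hρ).image f hfc.continuousOn

/-- For an integer multiplier, a segment in a suitable irrational direction wanders. -/
theorem exists_isEventuallySCWanderingContinuum (hω : 0 < ω.im) {k : ℤ} (hk : 1 < ‖(k : ℂ)‖)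
    (hA : IsAffine ω k b A) : ∃ E : Set (Torus ω), IsEventuallySCWanderingContinuum A E := by
  have hk1 : (k : ℂ) ≠ 1 := by
    intro h
    rw [h, norm_one] at hk
    exact lt_irrefl _ hk
  have hk0 : (k : ℂ) ≠ 0 := norm_pos_iff.1 (one_pos.trans hk)
  have hkabs : 1 < |(k : ℝ)| := by rwa [Complex.norm_intCast] at hk
  -- A fixed point of the lift.
  set z₀ : ℂ := b / (1 - k) with hz₀
  have hfix : (k : ℂ) * z₀ + b = z₀ := by
    have : (1 : ℂ) - k ≠ 0 := sub_ne_zero.2 hk1.symm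
    rw [hz₀]
    field_simp
    ring
  have hT : ∀ (n : ℕ) (u : ℂ), (fun z ↦ (k : ℂ) * z + b)^[n] (z₀ + u) = z₀ + k ^ n * u := by
    intro n u
    have h1 := iterate_affine_sub (k : ℂ) b (z₀ + u) z₀ n
    have h2 : (fun z ↦ (k : ℂ) * z + b)^[n] z₀ = z₀ := Function.iterate_fixed hfix n
    rw [h2, add_sub_cancel_left, sub_eq_iff_eq_add] at h1
    rw [h1, add_comm]
  -- A linear functional which is injective on the lattice.
  set c : ℝ := (√2 - ω.re) / ω.im with hc
  set φ : ℂ → ℝ := fun z ↦ z.re + c * z.im with hφ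
  have hφlat : ∀ n m : ℤ, φ (n + m * ω) = n + m * √2 := fun n m ↦ by
    simp only [hφ, hc, Complex.add_re, Complex.add_im, Complex.mul_re, Complex.mul_im,
      Complex.intCast_re, Complex.intCast_im]
    field_simp
    ring
  set v : ℂ := ⟨-c, 1⟩ with hv
  have hφv : ∀ x y : ℝ, φ (x + y * v) = x := fun x y ↦ by
    simp only [hφ, hv, Complex.add_re, Complex.add_im, Complex.mul_re, Complex.mul_im,
      Complex.ofReal_re, Complex.ofReal_im]
    ring
  have hv0 : v ≠ 0 := fun h ↦ by simpa [hv] using congr_arg Complex.im h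
  -- Relative to `z₀`, the `n`-th image has constant `φ`-value `k ^ n * τ`. Two images can meet
  -- modulo the lattice only if `(k ^ m - k ^ n) * τ` has the form `i + j * √2`, which excludes only
  -- countably many `τ`. A zero denominator merely adds the value `0`.
  obtain ⟨τ, hτ⟩ : ∃ τ : ℝ, τ ∉ range fun q : ℤ × ℤ × ℤ ↦ (q.1 + q.2.1 * √2) / (q.2.2 : ℝ) := by
    by_contra! h
    exact Cardinal.not_countable_real ((countable_range _).mono fun x _ ↦ h x)
  have hline : ∀ y : ℝ, (y : ℂ) * v ∈ lattice ω → y = 0 := by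
    rintro y ⟨n, m, h⟩
    have h1 := congr_arg φ h
    rw [hφlat, ← zero_add ((y : ℂ) * v), ← Complex.ofReal_zero, hφv] at h1
    have hm : m = 0 := by
      by_contra hm
      exact (irrational_sqrt_two.intCast_mul hm).ne_int (-n) (by push_cast; linarith)
    have hn : n = 0 := by
      rw [hm] at h1
      simpa using h1.symm
    rw [hn, hm] at h
    have h2 : (y : ℂ) * v = 0 := by simpa using h
    exact_mod_cast (mul_eq_zero.1 h2).resolve_right hv0
  set p : ℂ := z₀ + τ with hp
  set q : ℂ := z₀ + (τ + v) with hq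
  have hseg : segment ℝ p q = (fun t : ℝ ↦ z₀ + (τ + t * v)) '' Icc 0 1 := by
    rw [segment_eq_image']
    refine image_congr fun t _ ↦ ?_
    simp only [hp, hq, Complex.real_smul]
    ring
  have hTseg : ∀ n : ℕ, (fun z ↦ (k : ℂ) * z + b)^[n] '' segment ℝ p q =
      segment ℝ (z₀ + k ^ n * τ) (z₀ + k ^ n * (τ + v)) := by
    intro n
    rw [hseg, image_image, segment_eq_image']
    refine image_congr fun t _ ↦ ?_
    rw [hT, Complex.real_smul]
    ring
  have hE : ∀ n : ℕ, IsSimplyConnectedContinuum (A^[n] '' (proj ω '' segment ℝ p q)) := by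
    intro n
    have hkn : (k : ℂ) ^ n ≠ 0 := pow_ne_zero _ hk0
    rw [hA.iterate_image_proj, hTseg]
    refine isSimplyConnectedContinuum_segment hω ?_ ?_
    · intro h
      have h1 := mul_left_cancel₀ hkn (add_left_cancel h)
      exact hv0 (by simpa using h1)
    · rw [← hTseg, hseg, image_image]
      rintro _ ⟨s, -, rfl⟩ _ ⟨t, -, rfl⟩ hst
      simp only at hst ⊢
      rw [hT, hT, proj_eq_proj_iff] at hst
      have h1 : z₀ + (k : ℂ) ^ n * (τ + t * v) - (z₀ + k ^ n * (τ + s * v)) =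
          (((k : ℝ) ^ n * (t - s) : ℝ) : ℂ) * v := by
        push_cast
        ring
      rw [h1] at hst
      have h2 := hline _ hst
      have h3 : (k : ℝ) ^ n ≠ 0 := by exact_mod_cast hkn
      have h4 := (mul_eq_zero.1 h2).resolve_left h3
      have h5 : t = s := sub_eq_zero.1 h4
      rw [h5]
  refine ⟨proj ω '' segment ℝ p q, ⟨by simpa using (hE 0).1, ?_, ?_, ?_⟩, 0, fun n _ ↦ hE n⟩
  · simpa using (hE 0).2.1
  · refine ⟨proj ω p, ⟨p, left_mem_segment ℝ p q, rfl⟩, proj ω q,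
      ⟨q, right_mem_segment ℝ p q, rfl⟩, fun h ↦ ?_⟩
    rw [proj_eq_proj_iff] at h
    have h1 : q - p = ((1 : ℝ) : ℂ) * v := by
      rw [hp, hq]
      push_cast
      ring
    rw [h1] at h
    exact one_ne_zero (hline 1 h)
  · intro m n hmn
    rw [Set.disjoint_left]
    rw [hA.iterate_image_proj, hA.iterate_image_proj, hseg]
    rintro _ ⟨_, ⟨_, ⟨s, -, rfl⟩, rfl⟩, rfl⟩ ⟨_, ⟨_, ⟨t, -, rfl⟩, rfl⟩, hst⟩
    simp only at hst
    rw [hT, hT, proj_eq_proj_iff] at hst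
    obtain ⟨i, j, hij⟩ := hst
    have h1 : z₀ + (k : ℂ) ^ m * (τ + s * v) - (z₀ + k ^ n * (τ + t * v)) =
        (((k ^ m - k ^ n : ℤ) * τ : ℝ) : ℂ) + (((k : ℝ) ^ m * s - k ^ n * t : ℝ) : ℂ) * v := by
      push_cast
      ring
    rw [h1] at hij
    have h2 := congr_arg φ hij
    rw [hφv, hφlat] at h2
    have h3 : ((k ^ m - k ^ n : ℤ) : ℝ) ≠ 0 := by
      rw [Int.cast_ne_zero, sub_ne_zero]
      intro h
      have h4 : |(k : ℝ)| ^ m = |(k : ℝ)| ^ n := by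
        rw [← abs_pow, ← abs_pow]
        congr 1
        exact_mod_cast h
      exact (pow_lt_pow_right₀ hkabs hmn).ne h4
    refine hτ ⟨(i, j, k ^ m - k ^ n), ?_⟩
    simp only
    rw [div_eq_iff h3, ← h2]
    ring

end Existence

end FlatTorus

/-! ### The characterization of integer multipliers and the shape of the continua. -/

theorem theorem3p1 (ω : ℂ) (hω : 0 < ω.im) (a b : ℂ)
    (A : FlatTorus.Torus ω → FlatTorus.Torus ω) (hA : FlatTorus.IsAffine ω a b A)
    (d : ℕ) (hd : 2 ≤ d) (hcov : FlatTorus.IsCoveringOfDegree A d) :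
    ((∃ E : Set (FlatTorus.Torus ω), FlatTorus.IsEventuallySCWanderingContinuum A E) ↔
        ∃ k : ℤ, a = (k : ℂ)) ∧
      ∀ E : Set (FlatTorus.Torus ω), FlatTorus.IsEventuallySCWanderingContinuum A E →
        FlatTorus.IsLineSegmentInInfiniteGeodesic ω E := by
  have ha : 1 < ‖a‖ := hA.one_lt_norm hω hd hcov
  have hmain : ∀ E : Set (FlatTorus.Torus ω), FlatTorus.IsEventuallySCWanderingContinuum A E →
      (∃ k : ℤ, a = (k : ℂ)) ∧ FlatTorus.IsLineSegmentInInfiniteGeodesic ω E := by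
    intro E hE
    obtain ⟨K, hKc, hK, hKne, rfl, N, hN⟩ :=
      FlatTorus.exists_lift_of_isEventuallySCWanderingContinuum hω hA
        (norm_pos_iff.1 (one_pos.trans ha)) hcov.1.isLocalHomeomorph hE
    obtain ⟨z, w, hzw, rfl⟩ := PlanarContinuum.eq_segment_of_collinear hKc hK hKne
      (FlatTorus.collinear_of_pow_mul_sub_mem hω ha hKc hK hN)
    obtain ⟨k, rfl⟩ := FlatTorus.exists_int_of_im_eq_zero hω hA
      (FlatTorus.im_eq_zero_of_disjoint_iterate hω hA ha hzw hE.1.2.2.2)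
    exact ⟨⟨k, rfl⟩, FlatTorus.isLineSegmentInInfiniteGeodesic_segment hω ha hzw hN⟩
  refine ⟨⟨fun ⟨E, hE⟩ ↦ (hmain E hE).1, ?_⟩, fun E hE ↦ (hmain E hE).2⟩
  rintro ⟨k, rfl⟩
  exact FlatTorus.exists_isEventuallySCWanderingContinuum hω ha hA
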